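/- Let $(\mathcal B,\mathcal L,\theta,\mathcal I_\alpha)$ be a generalized Boolean dynamical system: $\mathcal B$ is a (not necessarily unital) Boolean algebra, $\mathcal L$ a set, each $\theta_a$ ($a\in\mathcal L$) a Boolean homomorphism $\mathcal B\to\mathcal B$ with $\theta_a(\emptyset)=\emptyset$, and each $\mathcal I_a$ an ideal of $\mathcal B$ containing every $A$ with $A\subseteq\theta_a(C)$ for some $C\in\mathcal B$. For a finite word $\alpha=\alpha_1\cdots\alpha_n$ put $\theta_\alpha=\theta_{\alpha_n}\circ\cdots\circ\theta_{\alpha_1}$ and $\mathcal I_\alpha=\{A: A\subseteq\theta_{\alpha_2\cdots\alpha_n}(C)\text{ for some }C\in\mathcal I_{\alpha_1}\}$, with $\theta_\emptyset=\mathrm{id}$ and $\mathcal I_\emptyset=\mathcal B$. Let $S=\{(\alpha,A,\beta):\alpha,\beta\in\mathcal L^*,\ \emptyset\ne A\in\mathcal I_\alpha\cap\mathcal I_\beta\}\cup\{0\}$ be the inverse semigroup with $(\alpha,A,\beta)^*=(\beta,A,\alpha)$ and product $(\alpha,A,\beta)(\beta\gamma',C,\delta)=(\alpha\gamma',\theta_{\gamma'}(A)\cap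 C,\delta)$, $(\alpha,A,\gamma\beta')(\gamma,C,\delta)=(\alpha,A\cap\theta_{\beta'}(C),\delta\beta')$ (read as $0$ if the middle set is empty), all other products being $0$. Let $E$ be its semilattice of idempotents and $\mathsf T$ its tight spectrum, the set of tight filters in $E$ with the topology of pointwise convergence of their characters. Every $\xi\in\mathsf T$ has an associated finite or infinite word, the smallest word $\omega$ such that $\beta$ is an initial segment of $\omega$ whenever $(\beta,A,\beta)\in\xi$; put $\xi_n=\{A\in\mathcal I_{\omega_1\cdots\omega_n}:(\omega_1\cdots\omega_n,A,\omega_1\cdots\omega_n)\in\xi\}$ for $0\le n\le|\omega|$, $n<\infty$. For $\xi\in\mathsf T$ with word $\alpha\gamma$, $\alpha$ finite, let $H_{[\alpha]\gamma}(\xi)\in\mathsf T$ (cutting) be the tight filter with word $\gamma$ whose $n$-th set is $\{C\in\mathcal I_{\gamma_1\cdots\gamma_n}: A\subseteq C\text{ for some }A\in\xi_{|\alpha|+n}\}$. For $\xi\in\mathsf T$ with word $\gamma$ and $\xi_0\cap\mathcal I_\alpha\neq\emptyset$, or $\alpha=\emptyset$, let $G_{(\alpha)\gamma}(\xi)\in\mathsf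 T$ (gluing) be the tight filter with word $\alpha\gamma$ whose set with index $|\alpha|+n$ is $\xi_n\cap\mathcal I_{\alpha\gamma_1\cdots\gamma_n}$ for $1\le n\le|\gamma|$ (also for $n=0$ if $\gamma=\emptyset$), and whose remaining sets $J_i$ are obtained successively by $J_i=\{A\in\mathcal I_{(\alpha\gamma)_1\cdots(\alpha\gamma)_i}:\theta_{(\alpha\gamma)_{i+1}}(A)\in J_{i+1}\}$. If $\alpha=\emptyset$, both are the identity. Let $\mathsf T^{(1)}$ be the set of $\xi\in\mathsf T$ whose word is non-empty, and let $\sigma:\mathsf T^{(1)}\to\mathsf T$, $\sigma(\xi)=H_{[a]\gamma}(\xi)$ if $\xi$ has the word $a\gamma$ with $a\in\mathcal L$. Let $$\Gamma=\{(\eta,|\alpha|-|\beta|,\xi)\in\mathsf T\times\mathbb Z\times\mathsf T:\ \eta,\xi\text{ have words }\alpha\gamma,\beta\gamma,\ H_{[\alpha]\gamma}(\eta)=H_{[\beta]\gamma}(\xi)\}$$ be the boundary path groupoid, with $(\eta,m,\xi)(\xi,n,\rho)=(\eta,m+n,\rho)$ and $(\eta,m,\xi)^{-1}=(\xi,-m,\eta)$.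 Let $\mathcal G_{tight}$ be the tight groupoid of $S$, that is, the germs $[s,\xi]$ with $s\in S$, $\xi\in\mathsf T$, $s^*s\in\xi$, where $[s,\xi]=[t,\zeta]$ iff $\xi=\zeta$ and $se=te$ for some $e\in\xi$, with the topology generated by the sets $\{[s,\xi]:\xi\in\mathcal U\}$ for $s \in S$ and open $\mathcal U\subseteq\{\xi\in\mathsf T: s^*s\in\xi\}$. Then: 1. $\mathsf T^{(1)}$ is open in $\mathsf T$. 2. $\sigma:\mathsf T^{(1)}\to\mathsf T$ is a local homeomorphism. 3. $\Gamma$ is the Renault–Deaconu groupoid of $\sigma$: $\Gamma=\{(\eta,m-n,\xi): m,n\in\mathbb N,\ \eta\in\operatorname{dom}\sigma^m,\ \xi\in\operatorname{dom}\sigma^n,\ \sigma^m(\eta)=\sigma^n(\xi)\}$, with the same operations. 4. There is a bijection $\Phi:\mathcal G_{tight}\to\Gamma$ with $\Phi([(\beta,A,\gamma),\xi])=\bigl(G_{(\beta)\gamma'}(H_{[\gamma]\gamma'}(\xi)),\,|\beta|-|\gamma|,\,\xi\bigr)$ whenever $(\gamma,A,\gamma)\in\xi$ and $\xi$ has the word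 $\gamma\gamma'$; and the topology on $\Gamma$ transported from $\mathcal G_{tight}$ by $\Phi$ coincides with the Renault–Deaconu topology, which is generated by the sets $$\mathcal V(X,m,n,Y)=\{(\eta,m-n,\xi):\eta\in X,\ \xi\in Y,\ \sigma^m(\eta)=\sigma^n(\xi)\},$$ where $m,n\in\mathbb N$, and $X$ and $Y$ are open subsets of $\mathsf T$ contained in $\operatorname{dom}\sigma^m$ and $\operatorname{dom}\sigma^n$ on which $\sigma^m$ and $\sigma^n$, respectively, are injective. -/

import Mathlib

/-! ## Generalized Boolean dynamical systems

Boolean algebras need not have a unit: they are Mathlib's `GeneralizedBooleanAlgebra`. -/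

/-- A generalized Boolean dynamical system `(B, L, θ, I_a)`: for every letter `a` an action
`θ a` on `B` (a Boolean homomorphism with `θ a ∅ = ∅`) and an ideal `I a` of `B` which contains
every element lying below an element of the range of `θ a`. -/
structure GBDS (B L : Type*) [GeneralizedBooleanAlgebra B] where
  θ : L → B → B
  map_inf : ∀ a A C, θ a (A ⊓ C) = θ a A ⊓ θ a C
  map_sup : ∀ a A C, θ a (A ⊔ C) = θ a A ⊔ θ a C
  map_sdiff : ∀ a A C, θ a (A \ C) = θ a A \ θ a C
  map_bot : ∀ a, θ a ⊥ = ⊥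
  I : L → Order.Ideal B
  range_subset : ∀ a A C, A ≤ θ a C → A ∈ I a

/-! ## Finite and infinite words -/

/-- The set `L^{≤ ∞}` of finite and (one-sided) infinite words in `L`. -/
inductive Word (L : Type*) where
  | fin (w : List L)
  | inf (x : ℕ → L)

namespace Word

variable {L : Type*}

/-- The length `|ω|`. -/
noncomputable def length : Word L → ℕ∞
  | fin w => (w.length : ℕ∞)
  | inf _ => ⊤

/-- The initial segment `ω_{1,n}` (all of `ω` if `n ≥ |ω|`). -/
def take : Word L → ℕ → List L
  | fin w, n => w.take n
  | inf x, n => (List.range n).map x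

/-- The concatenation `αγ` of a finite word with a finite or infinite word. -/
def append : List L → Word L → Word L
  | α, fin w => fin (α ++ w)
  | α, inf x => inf fun n => (α[n]?).getD (x (n - α.length))

theorem take_length_le (ω : Word L) (n : ℕ) : (ω.take n).length ≤ n := by
  cases ω <;> simp [take]

theorem length_take {ω : Word L} {n : ℕ} (h : (n : ℕ∞) ≤ ω.length) : (ω.take n).length = n := by
  cases ω with
  | fin w => simpa [take, length] using h
  | inf x => simp [take]

theorem beginning_le {ω : Word L} {β : List L} (h : ω.take β.length = β) :
    (β.length : ℕ∞) ≤ ω.length := by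
  cases ω with
  | fin w =>
    have : (w.take β.length).length = β.length := by
      have h' : w.take β.length = β := h
      rw [h']
    simp only [List.length_take] at this
    simp only [length, Nat.cast_le]
    omega
  | inf x => simp [length]

theorem take_prefix {ω : Word L} {β : List L} (h : ω.take β.length = β) {δ : List L}
    (hd : δ <+: β) : ω.take δ.length = δ := by
  obtain ⟨ε, rfl⟩ := hd
  cases ω with
  | fin w =>
    have h' : w.take (δ ++ ε).length = δ ++ ε := h
    have : (w.take (δ ++ ε).length).take δ.length = δ := by rw [h']; simp
    rw [List.take_take] at this
    simpa [take] using this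
  | inf x =>
    have h' : (List.range (δ ++ ε).length).map x = δ ++ ε := h
    have : ((List.range (δ ++ ε).length).map x).take δ.length = δ := by rw [h']; simp
    rw [← List.map_take, List.take_range] at this
    simpa [take] using this

theorem range_map_append (α : List L) (x : ℕ → L) (n : ℕ) :
    (List.range (α.length + n)).map (fun n => (α[n]?).getD (x (n - α.length)))
      = α ++ (List.range n).map x := by
  rw [List.range_add, List.map_append]
  congr 1
  · apply List.ext_getElem
    · simp
    · intro i h1 h2
      simp [List.getElem?_eq_getElem h2]
  · simp [List.map_map, Function.comp_def]

theorem take_append (α : List L) (γ : Word L) (n : ℕ) :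
    (append α γ).take (α.length + n) = α ++ γ.take n := by
  cases γ with
  | fin w => simp [append, take, List.take_append]
  | inf x => exact range_map_append α x n

theorem append_append (α κ : List L) (γ : Word L) :
    append (α ++ κ) γ = append α (append κ γ) := by
  cases γ with
  | fin w => simp [append]
  | inf x =>
    simp only [append, inf.injEq]
    funext n
    by_cases h : n < α.length
    · simp [List.getElem?_append_left h, List.getElem?_eq_getElem h]
    · have h' : α.length ≤ n := by omega
      rw [List.getElem?_append_right h', List.getElem?_eq_none h']
      simp [Nat.sub_sub]

theorem append_left_inj {α : List L} {γ γ' : Word L} (h : append α γ = append α γ') :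
    γ = γ' := by
  cases γ <;> cases γ' <;> simp only [append, fin.injEq, inf.injEq, reduceCtorEq] at h ⊢
  · simpa using h
  · funext n
    have := congrFun h (α.length + n)
    simpa using this

theorem append_take_length (α : List L) (γ : Word L) : (append α γ).take α.length = α := by
  have h0 : γ.take 0 = [] := by cases γ <;> simp [take]
  simpa [h0] using take_append α γ 0

theorem length_append_ge (α : List L) (γ : Word L) :
    (α.length : ℕ∞) ≤ (append α γ).length := by
  have := beginning_le (append_take_length α γ)
  exact this

/-- Two factorizations of one word through finite beginnings are comparable. -/
theorem append_eq_append {α β : List L} {γ δ : Word L} (h : append α γ = append β δ)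
    (hl : α.length ≤ β.length) : ∃ κ, β = α ++ κ ∧ γ = append κ δ := by
  have hb := append_take_length β δ
  rw [← h] at hb
  obtain ⟨k, hk⟩ := Nat.exists_eq_add_of_le hl
  rw [hk, take_append] at hb
  refine ⟨γ.take k, hb.symm, ?_⟩
  rw [← hb, append_append] at h
  exact append_left_inj h

/-- A word of length at least one is a letter followed by a word. -/
theorem exists_cons {ω : Word L} (h : 1 ≤ ω.length) :
    ∃ p : L × Word L, ω = append [p.1] p.2 := by
  cases ω with
  | fin w =>
    cases w with
    | nil => simp [length] at h
    | cons a w => exact ⟨(a, fin w), rfl⟩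
  | inf x =>
    refine ⟨(x 0, inf fun n => x (n + 1)), ?_⟩
    simp only [append, inf.injEq]
    funext n
    cases n <;> simp

end Word

/-! ## Filters, covers and tight filters on the idempotents of a semigroup with zero

These are applied to the inverse semigroup with zero of a generalized Boolean dynamical system. -/

section Tight

variable {S : Type*} [Mul S] [Zero S]

/-- A filter in the semilattice `E(S) = {e | e * e = e}`, with `e ≤ f` meaning `e * f = e`. -/
structure IsIdemFilter (ξ : Set S) : Prop where
  idem : ∀ e ∈ ξ, e * e = e
  nonempty : ξ.Nonempty
  zero_notMem : (0 : S) ∉ ξ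
  up : ∀ e ∈ ξ, ∀ f : S, f * f = f → e * f = e → f ∈ ξ
  directed : ∀ e ∈ ξ, ∀ f ∈ ξ, ∃ g ∈ ξ, g * e = g ∧ g * f = g

/-- `Z` is a cover for the idempotent `x`: a set of idempotents below `x` such that every nonzero
idempotent below `x` intersects a member of `Z`. -/
def IsCover (Z : Set S) (x : S) : Prop :=
  (∀ z ∈ Z, z * z = z ∧ z * x = z) ∧
    ∀ y : S, y * y = y → y * x = y → y ≠ 0 → ∃ z ∈ Z, z * y ≠ 0

/-- A tight filter: a filter `ξ` in `E(S)` whose character `φ e = [e ∈ ξ]` satisfies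
`⋁_{z ∈ Z} φ z = φ x` for every `x ∈ E(S)` and every finite cover `Z` for `x`. -/
def IsTightFilter (ξ : Set S) : Prop :=
  IsIdemFilter ξ ∧
    ∀ x : S, x * x = x → ∀ Z : Set S, Z.Finite → IsCover Z x → ((∃ z ∈ Z, z ∈ ξ) ↔ x ∈ ξ)

end Tight

/-- The tight spectrum `T`, as the set of tight filters in `E(S)`. -/
def TightSpectrum (S : Type*) [Mul S] [Zero S] : Type _ := {ξ : Set S // IsTightFilter ξ}

namespace TightSpectrum

variable {S : Type*} [Mul S] [Zero S]

open Classical in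
/-- The character of a tight filter, as a `{0,1}`-valued function on `E(S)`. -/
noncomputable def character (ξ : TightSpectrum S) : {e : S // e * e = e} → Bool :=
  fun e => decide (e.1 ∈ ξ.1)

/-- The topology of pointwise convergence of the characters. -/
noncomputable instance : TopologicalSpace (TightSpectrum S) :=
  TopologicalSpace.induced character inferInstance

end TightSpectrum

/-! ## The space of germs underlying the tight groupoid

Tight characters are identified with tight filters. -/

section Germs

variable (S : Type*) [Mul S] [Zero S] [Star S]

/-- `Ω = {(s, ξ) | ξ ∈ D_{s^* s}}`, where `D_e` is the set of tight filters containing `e`. -/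
def GermPair : Type _ := {p : S × TightSpectrum S // star p.1 * p.1 ∈ p.2.1}

/-- `(s, ξ) ∼ (t, ζ)` if `ξ = ζ` and `s * e = t * e` for some idempotent `e ∈ ξ`. -/
def GermRel (p q : GermPair S) : Prop :=
  p.1.2 = q.1.2 ∧ ∃ e : S, e * e = e ∧ e ∈ p.1.2.1 ∧ p.1.1 * e = q.1.1 * e

/-- The set of germs `[s, ξ]`, on which the tight groupoid `G_tight(S)` lives. For an inverse
semigroup with zero `GermRel` is an equivalence relation, and this is the set of its classes. -/
def TightGerm : Type _ := Quot (GermRel S)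

variable {S}

/-- The germ `[s, ξ]`. -/
def germ (s : S) (ξ : TightSpectrum S) (h : star s * s ∈ ξ.1) : TightGerm S :=
  Quot.mk _ ⟨(s, ξ), h⟩

/-- The topology of the tight groupoid, generated by the sets
`Θ(s, U) = {[s, ξ] | ξ ∈ U}` with `U` an open subset of `D_{s^* s}`. -/
instance : TopologicalSpace (TightGerm S) :=
  TopologicalSpace.generateFrom
    {W | ∃ (s : S) (U : Set (TightSpectrum S)), IsOpen U ∧
      ∃ hU : ∀ ξ ∈ U, star s * s ∈ ξ.1, W = {g | ∃ ξ, ∃ h : ξ ∈ U, g = germ s ξ (hU ξ h)}}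

end Germs

/-! ## Groupoids of triples and the Renault–Deaconu groupoid -/

/-- A groupoid with unit space `X` consisting of triples `(x, m, y) ∈ X × ℤ × X`, with product
`(x, m, y) (y, n, z) = (x, m + n, z)` and inverse `(x, m, y)⁻¹ = (y, -m, x)`. -/
@[ext] structure TripleGroupoid (X : Type*) where
  carrier : Set (X × ℤ × X)
  unit_mem : ∀ x, (x, (0 : ℤ), x) ∈ carrier
  mul_mem : ∀ x m y n z, (x, m, y) ∈ carrier → (y, n, z) ∈ carrier → (x, m + n, z) ∈ carrier
  inv_mem : ∀ x m y, (x, m, y) ∈ carrier → (y, -m, x) ∈ carrier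

section RenaultDeaconu

variable {X : Type*} {U : Set X}

/-- A map `σ : U → X`, `U ⊆ X`, as a partial map on `X`. -/
def toPartial (σ : U → X) : X →. X := fun x => ⟨x ∈ U, fun h => σ ⟨x, h⟩⟩

/-- The `n`-th power `σ^n` of a map `σ : U → X`, `U ⊆ X`, as a partial map on `X`:
its domain is `X` for `n = 0`, and `{x ∈ U | σ x ∈ dom σ^n}` for `n + 1`. -/
def partialPow (σ : U → X) : ℕ → (X →. X)
  | 0 => PFun.id X
  | n + 1 => (partialPow σ n).comp (toPartial σ)

theorem mem_partialPow_zero (σ : U → X) {x z : X} : z ∈ partialPow σ 0 x ↔ z = x := by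
  simp [partialPow, PFun.id]

theorem mem_partialPow_succ (σ : U → X) (n : ℕ) {x z : X} :
    z ∈ partialPow σ (n + 1) x ↔ ∃ h : x ∈ U, z ∈ partialPow σ n (σ ⟨x, h⟩) := by
  refine Part.mem_bind_iff.trans ?_
  constructor
  · rintro ⟨w, ⟨h, rfl⟩, hz⟩
    exact ⟨h, hz⟩
  · rintro ⟨h, hz⟩
    exact ⟨_, ⟨h, rfl⟩, hz⟩

theorem mem_partialPow_add (σ : U → X) (m n : ℕ) {x y z : X} (h : y ∈ partialPow σ m x) :
    z ∈ partialPow σ (m + n) x ↔ z ∈ partialPow σ n y := by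
  induction m generalizing x with
  | zero =>
    rw [mem_partialPow_zero] at h
    subst h
    simp
  | succ m ih =>
    rw [mem_partialPow_succ] at h
    obtain ⟨hx, hy⟩ := h
    rw [← ih hy, show m + 1 + n = (m + n) + 1 by omega, mem_partialPow_succ]
    exact ⟨fun ⟨_, hz⟩ => hz, fun hz => ⟨hx, hz⟩⟩

/-- The Renault–Deaconu groupoid
`{(x, m - n, y) | x ∈ dom σ^m, y ∈ dom σ^n, σ^m x = σ^n y}` of a map `σ : U → X`, `U ⊆ X`. -/
def renaultDeaconu (σ : U → X) : TripleGroupoid X where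
  carrier := {p | ∃ m n : ℕ, p.2.1 = (m : ℤ) - n ∧
    ∃ z, z ∈ partialPow σ m p.1 ∧ z ∈ partialPow σ n p.2.2}
  unit_mem x := ⟨0, 0, by simp, x, (mem_partialPow_zero σ).2 rfl, (mem_partialPow_zero σ).2 rfl⟩
  mul_mem := by
    rintro x k y l z ⟨m, n, hk, u, hux, huy⟩ ⟨m', n', hl, v, hvy, hvz⟩
    simp only at hk hl hux huy hvy hvz
    rcases le_total n m' with h | h
    · obtain ⟨i, rfl⟩ := Nat.exists_eq_add_of_le h
      rw [mem_partialPow_add σ n i huy] at hvy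
      refine ⟨m + i, n', ?_, v, (mem_partialPow_add σ m i hux).2 hvy, hvz⟩
      simp only
      omega
    · obtain ⟨i, rfl⟩ := Nat.exists_eq_add_of_le h
      rw [mem_partialPow_add σ m' i hvy] at huy
      refine ⟨m, n' + i, ?_, u, hux, (mem_partialPow_add σ n' i hvz).2 huy⟩
      simp only
      omega
  inv_mem := by
    rintro x k y ⟨m, n, hk, z, hx, hy⟩
    exact ⟨n, m, by simp only at hk ⊢; omega, z, hy, hx⟩

/-- The topology of the Renault–Deaconu groupoid, generated by the sets
`V(A, m, n, B) = {(x, m - n, y) | x ∈ A, y ∈ B, σ^m x = σ^n y}`, where `A` and `B` are open subsets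
of `dom σ^m` and `dom σ^n` on which `σ^m` and `σ^n`, respectively, are injective. -/
@[reducible] def renaultDeaconuTopology [TopologicalSpace X] (σ : U → X) :
    TopologicalSpace (renaultDeaconu σ).carrier :=
  TopologicalSpace.generateFrom
    {W | ∃ (A : Set X) (m n : ℕ) (B : Set X),
      IsOpen A ∧ A ⊆ (partialPow σ m).Dom ∧
      (∀ x ∈ A, ∀ x' ∈ A, partialPow σ m x = partialPow σ m x' → x = x') ∧
      IsOpen B ∧ B ⊆ (partialPow σ n).Dom ∧
      (∀ y ∈ B, ∀ y' ∈ B, partialPow σ n y = partialPow σ n y' → y = y') ∧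
      W = {p | p.1.2.1 = (m : ℤ) - n ∧ p.1.1 ∈ A ∧ p.1.2.2 ∈ B ∧
        partialPow σ m p.1.1 = partialPow σ n p.1.2.2}}

end RenaultDeaconu

/-! ## The inverse semigroup of a generalized Boolean dynamical system -/

namespace GBDS

variable {B L : Type*} [GeneralizedBooleanAlgebra B] (D : GBDS B L)

/-- `θ_α = θ_{α_n} ∘ ⋯ ∘ θ_{α_1}` for a finite word `α = α_1 ⋯ α_n`, and `θ_∅ = id`. -/
def act (α : List L) (A : B) : B := α.foldl (fun C a => D.θ a C) A

/-- `I_∅ = B`, and `I_α = {A | A ⊆ θ_{α_2 ⋯ α_n}(C) for some C ∈ I_{α_1}}` for a finite word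
`α = α_1 ⋯ α_n` with `n ≥ 1`. -/
def ideal : List L → Set B
  | [] => Set.univ
  | a :: w => {A | ∃ C ∈ D.I a, A ≤ D.act w C}

theorem act_append (v w : List L) (A : B) : D.act (v ++ w) A = D.act w (D.act v A) := by
  simp [act]

theorem act_inf (w : List L) (A C : B) : D.act w (A ⊓ C) = D.act w A ⊓ D.act w C := by
  induction w generalizing A C with
  | nil => rfl
  | cons a w ih =>
    have := ih (D.θ a A) (D.θ a C)
    rw [← D.map_inf] at this
    exact this

theorem act_bot (w : List L) : D.act w ⊥ = ⊥ := by
  induction w with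
  | nil => rfl
  | cons a w ih =>
    have h : D.act (a :: w) ⊥ = D.act w (D.θ a ⊥) := rfl
    rw [h, D.map_bot, ih]

theorem act_mono (w : List L) {A C : B} (h : A ≤ C) : D.act w A ≤ D.act w C := by
  have := D.act_inf w A C
  rw [inf_eq_left.2 h] at this
  exact inf_eq_left.1 this.symm

theorem ideal_lower {w : List L} {A C : B} (h : A ≤ C) (hC : C ∈ D.ideal w) : A ∈ D.ideal w := by
  cases w with
  | nil => trivial
  | cons a w =>
    obtain ⟨E, hE, hCE⟩ := hC
    exact ⟨E, hE, h.trans hCE⟩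

theorem act_mem_ideal {v : List L} (w : List L) {A : B} (hA : A ∈ D.ideal v) :
    D.act w A ∈ D.ideal (v ++ w) := by
  cases v with
  | nil =>
    cases w with
    | nil => trivial
    | cons a w => exact ⟨D.θ a A, D.range_subset a _ A le_rfl, le_rfl⟩
  | cons a v =>
    obtain ⟨C, hC, hAC⟩ := hA
    refine ⟨C, hC, ?_⟩
    change D.act w A ≤ D.act (v ++ w) C
    rw [act_append]
    exact D.act_mono w hAC

theorem ideal_append_subset (v w : List L) {A : B} (hA : A ∈ D.ideal (v ++ w)) :
    A ∈ D.ideal w := by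
  cases v with
  | nil => exact hA
  | cons a v =>
    obtain ⟨C, hC, hAC⟩ := hA
    change A ≤ D.act (v ++ w) C at hAC
    rw [act_append] at hAC
    exact D.ideal_lower hAC (D.act_mem_ideal (v := []) w trivial)

theorem exists_mem_ideal_of_append (v w : List L) {A C : B} (hA : A ∈ D.ideal (v ++ w))
    (hAC : A ≤ D.act w C) : ∃ E ∈ D.ideal v, E ≤ C ∧ A ≤ D.act w E := by
  cases v with
  | nil => exact ⟨C, trivial, le_rfl, hAC⟩
  | cons a v =>
    obtain ⟨F, hF, hAF⟩ := hA
    change A ≤ D.act (v ++ w) F at hAF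
    rw [act_append] at hAF
    refine ⟨D.act v F ⊓ C, ⟨F, hF, inf_le_left⟩, inf_le_right, ?_⟩
    rw [act_inf]
    exact le_inf hAF hAC

/-- A nonzero element `(α, A, β)` of the inverse semigroup. -/
@[ext] structure Triple where
  left : List L
  set : B
  right : List L
  mem_left : set ∈ D.ideal left
  mem_right : set ∈ D.ideal right
  ne_bot : set ≠ ⊥

/-- The set `S = {(α, A, β) | ∅ ≠ A ∈ I_α ∩ I_β} ∪ {0}`. -/
inductive Sgp where
  | zero : Sgp
  | of (p : D.Triple) : Sgp

instance : Zero D.Sgp := ⟨Sgp.zero⟩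

open Classical in
/-- The element `(α, A, β)` of `S` if `∅ ≠ A ∈ I_α ∩ I_β`, and `0` otherwise. -/
noncomputable def elt (α : List L) (A : B) (β : List L) : D.Sgp :=
  if h : A ∈ D.ideal α ∧ A ∈ D.ideal β ∧ A ≠ ⊥ then .of ⟨α, A, β, h.1, h.2.1, h.2.2⟩ else 0

open Classical in
/-- The product of `S`: `(α, A, β) (βγ', C, δ) = (αγ', θ_{γ'}(A) ∩ C, δ)` and
`(α, A, γβ') (γ, C, δ) = (α, A ∩ θ_{β'}(C), δβ')`, understood as `0` if the set in the middle is
empty; all other products are `0`. In the first two cases the set in the middle is always an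
element of the two ideals that `elt` asks for. -/
noncomputable instance : Mul D.Sgp where
  mul
    | .of p, .of q =>
      if p.right <+: q.left then
        D.elt (p.left ++ q.left.drop p.right.length)
          (D.act (q.left.drop p.right.length) p.set ⊓ q.set) q.right
      else if q.left <+: p.right then
        D.elt p.left (p.set ⊓ D.act (p.right.drop q.left.length) q.set)
          (q.right ++ p.right.drop q.left.length)
      else 0
    | _, _ => 0

/-- The involution `(α, A, β)^* = (β, A, α)`, `0^* = 0`. -/
instance : Star D.Sgp where
  star
    | .of p => .of ⟨p.right, p.set, p.left, p.mem_right, p.mem_left, p.ne_bot⟩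
    | .zero => 0

variable {D}

theorem elt_eq_zero {α β : List L} {A : B} (h : ¬(A ∈ D.ideal α ∧ A ∈ D.ideal β ∧ A ≠ ⊥)) :
    D.elt α A β = 0 := dif_neg h

theorem of_elt_ne_zero {α β : List L} {A : B} (h : D.elt α A β ≠ 0) :
    A ∈ D.ideal α ∧ A ∈ D.ideal β ∧ A ≠ ⊥ := by
  by_contra h'
  exact h (elt_eq_zero h')

theorem elt_ne_zero {α β : List L} {A : B} (h1 : A ∈ D.ideal α) (h2 : A ∈ D.ideal β)
    (h3 : A ≠ ⊥) : D.elt α A β ≠ 0 := by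
  unfold elt
  rw [dif_pos ⟨h1, h2, h3⟩]
  exact fun h => by cases h

theorem elt_inj {α β γ δ : List L} {A C : B} (h : D.elt α A β ≠ 0)
    (he : D.elt α A β = D.elt γ C δ) : α = γ ∧ A = C ∧ β = δ := by
  have h' : D.elt γ C δ ≠ 0 := he ▸ h
  have h1 := of_elt_ne_zero h
  have h2 := of_elt_ne_zero h'
  unfold elt at he
  rw [dif_pos h1, dif_pos h2] at he
  have := Sgp.of.inj he
  rw [Triple.mk.injEq] at this
  exact this

theorem exists_elt (s : D.Sgp) (h : s ≠ 0) : ∃ α A β, s = D.elt α A β := by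
  rcases s with _ | p
  · exact absurd rfl h
  · refine ⟨p.left, p.set, p.right, ?_⟩
    unfold elt
    rw [dif_pos ⟨p.mem_left, p.mem_right, p.ne_bot⟩]

theorem zero_mul' (s : D.Sgp) : (0 : D.Sgp) * s = 0 := rfl

theorem mul_zero' (s : D.Sgp) : s * (0 : D.Sgp) = 0 := by
  cases s <;> rfl

open Classical in
theorem elt_mul_elt {α β γ δ : List L} {A C : B} (h1 : D.elt α A β ≠ 0) (h2 : D.elt γ C δ ≠ 0) :
    D.elt α A β * D.elt γ C δ =
      if β <+: γ then
        D.elt (α ++ γ.drop β.length) (D.act (γ.drop β.length) A ⊓ C) δ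
      else if γ <+: β then
        D.elt α (A ⊓ D.act (β.drop γ.length) C) (δ ++ β.drop γ.length)
      else 0 := by
  have h1' := of_elt_ne_zero h1
  have h2' := of_elt_ne_zero h2
  have e1 : D.elt α A β = .of ⟨α, A, β, h1'.1, h1'.2.1, h1'.2.2⟩ := dif_pos h1'
  have e2 : D.elt γ C δ = .of ⟨γ, C, δ, h2'.1, h2'.2.1, h2'.2.2⟩ := dif_pos h2'
  rw [e1, e2]
  rfl

theorem elt_mul_elt_append {α β γ' δ : List L} {A C : B} (h1 : D.elt α A β ≠ 0)
    (h2 : D.elt (β ++ γ') C δ ≠ 0) :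
    D.elt α A β * D.elt (β ++ γ') C δ = D.elt (α ++ γ') (D.act γ' A ⊓ C) δ := by
  rw [elt_mul_elt h1 h2, if_pos (List.prefix_append _ _)]
  simp

theorem elt_append_mul_elt {α β' γ δ : List L} {A C : B} (h1 : D.elt α A (γ ++ β') ≠ 0)
    (h2 : D.elt γ C δ ≠ 0) :
    D.elt α A (γ ++ β') * D.elt γ C δ = D.elt α (A ⊓ D.act β' C) (δ ++ β') := by
  rw [elt_mul_elt h1 h2]
  split_ifs with h h'
  · have : β' = [] := by
      have := h.length_le
      simp only [List.length_append] at this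
      exact List.length_eq_zero_iff.1 (by omega)
    subst this
    simp [act]
  · simp
  · exact absurd (List.prefix_append _ _) h'

theorem comparable_of_mul_ne_zero {α β γ δ : List L} {A C : B}
    (h : D.elt α A β * D.elt γ C δ ≠ 0) : β <+: γ ∨ γ <+: β := by
  have h1 : D.elt α A β ≠ 0 := fun h' => h (by rw [h', zero_mul'])
  have h2 : D.elt γ C δ ≠ 0 := fun h' => h (by rw [h', mul_zero'])
  rw [elt_mul_elt h1 h2] at h
  split_ifs at h with h3 h4
  · exact Or.inl h3
  · exact Or.inr h4
  · exact absurd rfl h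

theorem elt_idem (α : List L) (A : B) : D.elt α A α * D.elt α A α = D.elt α A α := by
  by_cases h : D.elt α A α = 0
  · rw [h, zero_mul']
  · have := elt_append_mul_elt (β' := []) (D := D) (by simpa using h) h
    simpa [act] using this

theorem eq_of_idem {α β : List L} {A : B} (h : D.elt α A β ≠ 0)
    (he : D.elt α A β * D.elt α A β = D.elt α A β) : β = α := by
  rcases comparable_of_mul_ne_zero (he ▸ h) with h' | h'
  · obtain ⟨γ, rfl⟩ := h'
    rw [elt_mul_elt_append h h] at he
    have := (elt_inj h he.symm).1
    simpa using this
  · obtain ⟨γ, rfl⟩ := h'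
    rw [elt_append_mul_elt h h] at he
    have := (elt_inj h he.symm).2.2
    simpa using this

theorem exists_elt_of_idem {e : D.Sgp} (h : e ≠ 0) (he : e * e = e) :
    ∃ α A, e = D.elt α A α := by
  obtain ⟨α, A, β, rfl⟩ := exists_elt e h
  have := eq_of_idem h he
  subst this
  exact ⟨_, _, rfl⟩

/-- The order of `E(S)`. -/
theorem elt_le_elt {α β : List L} {A C : B} (h1 : D.elt α A α ≠ 0) (h2 : D.elt β C β ≠ 0) :
    D.elt α A α * D.elt β C β = D.elt α A α ↔ ∃ γ, α = β ++ γ ∧ A ≤ D.act γ C := by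
  constructor
  · intro h
    rcases comparable_of_mul_ne_zero (h ▸ h1) with h' | h'
    · obtain ⟨γ, rfl⟩ := h'
      rw [elt_mul_elt_append h1 h2] at h
      obtain ⟨h3, h4, -⟩ := elt_inj h1 h.symm
      have : γ = [] := by simpa using h3
      subst this
      exact ⟨[], by simp, inf_eq_left.1 h4.symm⟩
    · obtain ⟨γ, rfl⟩ := h'
      rw [elt_append_mul_elt h1 h2] at h
      exact ⟨γ, rfl, inf_eq_left.1 (elt_inj h1 h.symm).2.1.symm⟩
  · rintro ⟨γ, rfl, h⟩
    rw [elt_append_mul_elt h1 h2, inf_eq_left.2 h]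

variable (D)

/-! ## The word and the complete family of a filter in `E(S)` -/

/-- `ω` is the word associated with `ξ`: the words occurring in `ξ` are initial segments of `ω`,
and `ω` is not longer than needed for this. -/
def IsWordOf (ξ : Set D.Sgp) (ω : Word L) : Prop :=
  (∀ β A, D.elt β A β ∈ ξ → ω.take β.length = β) ∧
    ∀ n : ℕ, (n : ℕ∞) ≤ ω.length → ∃ β A, D.elt β A β ∈ ξ ∧ n ≤ β.length

variable {D}

theorem comparable_of_mem {ξ : Set D.Sgp} (h : IsIdemFilter ξ) {β γ : List L} {A C : B}
    (h1 : D.elt β A β ∈ ξ) (h2 : D.elt γ C γ ∈ ξ) (hl : β.length ≤ γ.length) : β <+: γ := by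
  obtain ⟨g, hg, hg1, hg2⟩ := h.directed _ h1 _ h2
  have hg0 : g ≠ 0 := fun h0 => h.zero_notMem (h0 ▸ hg)
  obtain ⟨δ, E, rfl⟩ := exists_elt_of_idem hg0 (h.idem _ hg)
  have h10 : D.elt β A β ≠ 0 := fun h0 => h.zero_notMem (h0 ▸ h1)
  have h20 : D.elt γ C γ ≠ 0 := fun h0 => h.zero_notMem (h0 ▸ h2)
  obtain ⟨ε, hε, -⟩ := (elt_le_elt hg0 h10).1 hg1
  obtain ⟨ζ, hζ, -⟩ := (elt_le_elt hg0 h20).1 hg2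
  exact List.prefix_of_prefix_length_le ⟨ε, hε.symm⟩ ⟨ζ, hζ.symm⟩ hl

theorem exists_isWordOf {ξ : Set D.Sgp} (h : IsIdemFilter ξ) : ∃ ω, D.IsWordOf ξ ω := by
  by_cases hb : ∀ n : ℕ, ∃ β A, D.elt β A β ∈ ξ ∧ n < β.length
  · choose β A hmem hlen using hb
    refine ⟨Word.inf fun n => (β n)[n]'(hlen n), ?_, fun n _ => ⟨β n, A n, hmem n, (hlen n).le⟩⟩
    intro γ C hγ
    apply List.ext_getElem
    · simp [Word.take]
    · intro i h1 h2
      simp only [Word.take, List.getElem_map, List.getElem_range]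
      rcases le_total γ.length (β i).length with hl | hl
      · exact ((comparable_of_mem h hγ (hmem i) hl).getElem h2).symm
      · exact (comparable_of_mem h (hmem i) hγ hl).getElem (hlen i)
  · push Not at hb
    obtain ⟨N, hN⟩ := hb
    have hne : ∃ k, ∃ β A, D.elt β A β ∈ ξ ∧ β.length = k := by
      obtain ⟨e, he⟩ := h.nonempty
      have he0 : e ≠ 0 := fun h0 => h.zero_notMem (h0 ▸ he)
      obtain ⟨α, A, rfl⟩ := exists_elt_of_idem he0 (h.idem _ he)
      exact ⟨_, α, A, he, rfl⟩
    classical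
    have hmax : ∃ α A, D.elt α A α ∈ ξ ∧ ∀ β C, D.elt β C β ∈ ξ → β.length ≤ α.length := by
      obtain ⟨k, β, A, hβ, hk⟩ := hne
      have hk' : ∃ β A, D.elt β A β ∈ ξ ∧ β.length = k := ⟨β, A, hβ, hk⟩
      have hkN : k ≤ N := hk ▸ hN β A hβ
      obtain ⟨α, C, hα, hαl⟩ := Nat.findGreatest_spec
        (P := fun k => ∃ β A, D.elt β A β ∈ ξ ∧ β.length = k) hkN hk'
      refine ⟨α, C, hα, fun γ E hγ => ?_⟩
      rw [hαl]
      exact Nat.le_findGreatest (hN γ E hγ) ⟨γ, E, hγ, rfl⟩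
    obtain ⟨α, A, hα, hm⟩ := hmax
    refine ⟨Word.fin α, ?_, ?_⟩
    · intro γ C hγ
      exact (List.prefix_iff_eq_take.1 (comparable_of_mem h hγ hα (hm γ C hγ))).symm
    · intro n hn
      exact ⟨α, A, hα, by simpa [Word.length] using hn⟩

variable (D)

/-- The tight spectrum `T` of a generalized Boolean dynamical system. -/
abbrev T : Type _ := TightSpectrum D.Sgp

variable {D}

/-- The word associated with a tight filter. -/
noncomputable def word (ξ : D.T) : Word L := (exists_isWordOf ξ.2.1).choose

theorem isWordOf_word (ξ : D.T) : D.IsWordOf ξ.1 (word ξ) := (exists_isWordOf ξ.2.1).choose_spec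

variable (D)

/-- `T^{(1)}`, the set of tight filters whose word is not empty. -/
def T1 : Set D.T := {ξ | 1 ≤ (word ξ).length}

/-- The family `ξ_n = {A ∈ I_{ω_{1,n}} | (ω_{1,n}, A, ω_{1,n}) ∈ ξ}` of a filter `ξ` with
word `ω`. -/
def family (ξ : Set D.Sgp) (ω : Word L) (n : ℕ) : Set B :=
  {A ∈ D.ideal (ω.take n) | D.elt (ω.take n) A (ω.take n) ∈ ξ}

/-- The filter `⋃_{0 ≤ n ≤ |ω|} ⋃_{A ∈ F_n} ↑(ω_{1,n}, A, ω_{1,n})` in `E(S)` associated with a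
family `(F_n)` for the word `ω`. -/
def filterOf (ω : Word L) (F : ℕ → Set B) : Set D.Sgp :=
  {e | e * e = e ∧ ∃ n : ℕ, (n : ℕ∞) ≤ ω.length ∧ ∃ A ∈ F n,
    D.elt (ω.take n) A (ω.take n) * e = D.elt (ω.take n) A (ω.take n)}

/-! ## Cutting and gluing -/

/-- `f_{α[β]} F = {A ∈ I_α | θ_β(A) ∈ F}`, for `F ⊆ I_{αβ}`. -/
def fMap (α β : List L) (F : Set B) : Set B := {A ∈ D.ideal α | D.act β A ∈ F}

/-- `g_{(α)β} F = F ∩ I_{αβ}`, for `F ⊆ I_β`. -/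
def gMap (α β : List L) (F : Set B) : Set B := F ∩ D.ideal (α ++ β)

/-- `h_{[α]β} F = {C ∈ I_β | A ⊆ C for some A ∈ F}`, for `F ⊆ I_{αβ}`. -/
def hMap (β : List L) (F : Set B) : Set B := {C ∈ D.ideal β | ∃ A ∈ F, A ≤ C}

/-- The filter `H_{[α]γ}(ξ)` cut from a filter `ξ` with word `αγ`: the filter associated with the
family `h_{[α]γ_{1,n}}(ξ_{|α|+n})`, `0 ≤ n ≤ |γ|`, for the word `γ`. For `α = ∅` this is `ξ`. -/
def cutFilter (α : List L) (γ : Word L) (ξ : Set D.Sgp) : Set D.Sgp :=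
  D.filterOf γ fun n => D.hMap (γ.take n) (D.family ξ (Word.append α γ) (α.length + n))

/-- The family `(J_i)` for `αγ` glued from a family `(F_k)` for `γ`. Let `k = 0` if `γ = ∅` and
`k = 1` otherwise. Then `J_{|α|+j} = g_{(α)γ_{1,j}}(F_j)` for `j ≥ k`, and the sets `J_i` with
`i < |α| + k` are obtained from `J_{|α|+k}` by the maps `f`. -/
noncomputable def gluedFamily (α : List L) (γ : Word L) (F : ℕ → Set B) (i : ℕ) : Set B :=
  letI k : ℕ := if γ.length = 0 then 0 else 1
  if α.length + k ≤ i then D.gMap α (γ.take (i - α.length)) (F (i - α.length))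
  else D.fMap ((Word.append α γ).take i) (((Word.append α γ).take (α.length + k)).drop i)
    (D.gMap α (γ.take k) (F k))

/-- The filter `G_{(α)γ}(ξ)` glued from a filter `ξ` with word `γ` and `ξ_0 ∩ I_α ≠ ∅`: the
filter associated with the glued family for the word `αγ`. For `α = ∅` this is `ξ`. -/
noncomputable def glueFilter (α : List L) (γ : Word L) (ξ : Set D.Sgp) : Set D.Sgp :=
  D.filterOf (Word.append α γ) (D.gluedFamily α γ (D.family ξ γ))

variable {D}

theorem ne_zero_of_mem {ξ : Set D.Sgp} (h : IsIdemFilter ξ) {e : D.Sgp} (he : e ∈ ξ) : e ≠ 0 :=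
  fun h0 => h.zero_notMem (h0 ▸ he)

theorem elt_up {ξ : Set D.Sgp} (h : IsIdemFilter ξ) {β γ : List L} {A C : B}
    (hA : D.elt (β ++ γ) A (β ++ γ) ∈ ξ) (hC : C ∈ D.ideal β) (hAC : A ≤ D.act γ C) :
    D.elt β C β ∈ ξ := by
  have h0 := ne_zero_of_mem h hA
  have hC0 : C ≠ ⊥ := by
    rintro rfl
    rw [act_bot] at hAC
    exact (of_elt_ne_zero h0).2.2 (le_bot_iff.1 hAC)
  exact h.up _ hA _ (elt_idem _ _) ((elt_le_elt h0 (elt_ne_zero hC hC hC0)).2 ⟨γ, rfl, hAC⟩)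

/-- The elements of a cut filter. -/
theorem mem_cutFilter {ξ : Set D.Sgp} (h : IsIdemFilter ξ) {α : List L} {γ : Word L}
    {e : D.Sgp} : e ∈ D.cutFilter α γ ξ ↔ ∃ δ C A, e = D.elt δ C δ ∧ γ.take δ.length = δ ∧
      C ∈ D.ideal δ ∧ A ≤ C ∧ D.elt (α ++ δ) A (α ++ δ) ∈ ξ := by
  constructor
  · rintro ⟨he, n, hn, E, ⟨hE, A, ⟨hA, hAξ⟩, hAE⟩, hle⟩
    rw [Word.take_append] at hA hAξ
    have hA0 := ne_zero_of_mem h hAξ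
    have hE0 : E ≠ ⊥ := by
      rintro rfl
      exact (of_elt_ne_zero hA0).2.2 (le_bot_iff.1 hAE)
    have hE' := elt_ne_zero hE hE hE0
    have he0 : e ≠ 0 := by
      rintro rfl
      rw [mul_zero'] at hle
      exact hE' hle.symm
    obtain ⟨δ, C, rfl⟩ := exists_elt_of_idem he0 he
    obtain ⟨ε, hε, hEC⟩ := (elt_le_elt hE' he0).1 hle
    have hnl := Word.length_take hn
    have hδ : γ.take δ.length = δ := by
      refine Word.take_prefix (β := γ.take n) (by rw [hnl]) ⟨ε, hε.symm⟩
    rw [hε, ← List.append_assoc] at hA hAξ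
    obtain ⟨F, hF, hFC, hAF⟩ := D.exists_mem_ideal_of_append _ _ hA (hAE.trans hEC)
    exact ⟨δ, C, F, rfl, hδ, (of_elt_ne_zero he0).1, hFC, elt_up h hAξ hF hAF⟩
  · rintro ⟨δ, C, A, rfl, hδ, hC, hAC, hA⟩
    refine ⟨elt_idem _ _, δ.length, Word.beginning_le hδ, C, ⟨?_, A, ⟨?_, ?_⟩, hAC⟩, ?_⟩
    · rwa [hδ]
    · rw [Word.take_append, hδ]
      exact (of_elt_ne_zero (ne_zero_of_mem h hA)).1
    · rwa [Word.take_append, hδ]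
    · rw [hδ]
      exact elt_idem _ _

theorem elt_mem_cutFilter {ξ : Set D.Sgp} (h : IsIdemFilter ξ) {α : List L} {γ : Word L}
    {δ : List L} {C A : B} (hδ : γ.take δ.length = δ) (hC : C ∈ D.ideal δ) (hAC : A ≤ C)
    (hA : D.elt (α ++ δ) A (α ++ δ) ∈ ξ) : D.elt δ C δ ∈ D.cutFilter α γ ξ :=
  (mem_cutFilter h).2 ⟨δ, C, A, rfl, hδ, hC, hAC, hA⟩

theorem of_elt_mem_cutFilter {ξ : Set D.Sgp} (h : IsIdemFilter ξ) {α : List L} {γ : Word L}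
    {δ : List L} {C : B} (hm : D.elt δ C δ ∈ D.cutFilter α γ ξ) :
    γ.take δ.length = δ ∧ C ∈ D.ideal δ ∧ ∃ A ≤ C, D.elt (α ++ δ) A (α ++ δ) ∈ ξ := by
  obtain ⟨δ', C', A, he, hδ, hC, hAC, hA⟩ := (mem_cutFilter h).1 hm
  have hne : D.elt δ' C' δ' ≠ 0 := by
    refine elt_ne_zero hC hC ?_
    rintro rfl
    exact (of_elt_ne_zero (ne_zero_of_mem h hA)).2.2 (le_bot_iff.1 hAC)
  obtain ⟨rfl, rfl, -⟩ := elt_inj hne he.symm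
  exact ⟨hδ, hC, A, hAC, hA⟩

theorem elt_ne_zero_of_le {α δ : List L} {C A : B} (hC : C ∈ D.ideal δ) (hAC : A ≤ C)
    (hA : D.elt (α ++ δ) A (α ++ δ) ≠ 0) : D.elt δ C δ ≠ 0 := by
  refine elt_ne_zero hC hC ?_
  rintro rfl
  exact (of_elt_ne_zero hA).2.2 (le_bot_iff.1 hAC)

theorem isIdemFilter_cutFilter {ξ : Set D.Sgp} (h : IsIdemFilter ξ) {α : List L} {γ : Word L}
    (hw : D.IsWordOf ξ (Word.append α γ)) : IsIdemFilter (D.cutFilter α γ ξ) := by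
  have key : ∀ ε A, D.elt (α ++ ε) A (α ++ ε) ∈ ξ → γ.take ε.length = ε := by
    intro ε A hA
    have := hw.1 _ _ hA
    rw [List.length_append, Word.take_append] at this
    exact List.append_cancel_left this
  have pref : ∀ β A, D.elt β A β ∈ ξ → α.length ≤ β.length → ∃ δ, β = α ++ δ := by
    intro β A hA hl
    obtain ⟨k, hk⟩ := Nat.exists_eq_add_of_le hl
    have := hw.1 _ _ hA
    rw [hk, Word.take_append] at this
    exact ⟨_, this.symm⟩
  refine ⟨fun e he => he.1, ?_, ?_, ?_, ?_⟩
  · obtain ⟨β, A, hA, hl⟩ := hw.2 α.length (Word.length_append_ge α γ)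
    obtain ⟨δ, rfl⟩ := pref _ _ hA hl
    exact ⟨_, elt_mem_cutFilter h (key _ _ hA)
      (D.ideal_append_subset α δ (of_elt_ne_zero (ne_zero_of_mem h hA)).1) le_rfl hA⟩
  · intro h0
    obtain ⟨δ, C, A, he, -, hC, hAC, hA⟩ := (mem_cutFilter h).1 h0
    exact elt_ne_zero_of_le hC hAC (ne_zero_of_mem h hA) he.symm
  · intro e he f hf hef
    obtain ⟨δ, C, A, rfl, hδ, hC, hAC, hA⟩ := (mem_cutFilter h).1 he
    have hA0 := ne_zero_of_mem h hA
    have he0 := elt_ne_zero_of_le hC hAC hA0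
    have hf0 : f ≠ 0 := by
      rintro rfl
      rw [mul_zero'] at hef
      exact he0 hef.symm
    obtain ⟨δ', C', rfl⟩ := exists_elt_of_idem hf0 hf
    obtain ⟨ε, rfl, hCC'⟩ := (elt_le_elt he0 hf0).1 hef
    rw [← List.append_assoc] at hA
    obtain ⟨F, hF, hFC, hAF⟩ := D.exists_mem_ideal_of_append (α ++ δ') ε
      (by simpa using (of_elt_ne_zero (by simpa using hA0)).1) (hAC.trans hCC')
    exact elt_mem_cutFilter h (Word.take_prefix hδ (List.prefix_append _ _))
      (of_elt_ne_zero hf0).1 hFC (elt_up h hA hF hAF)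
  · intro e he f hf
    obtain ⟨δ, C, A, rfl, hδ, hC, hAC, hA⟩ := (mem_cutFilter h).1 he
    obtain ⟨δ', C', A', rfl, hδ', hC', hAC', hA'⟩ := (mem_cutFilter h).1 hf
    obtain ⟨g, hg, hg1, hg2⟩ := h.directed _ hA _ hA'
    have hg0 := ne_zero_of_mem h hg
    obtain ⟨κ, E, rfl⟩ := exists_elt_of_idem hg0 (h.idem _ hg)
    have hA0 := ne_zero_of_mem h hA
    have hA0' := ne_zero_of_mem h hA'
    obtain ⟨ε, rfl, hE⟩ := (elt_le_elt hg0 hA0).1 hg1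
    obtain ⟨ε', hε', hE'⟩ := (elt_le_elt hg0 hA0').1 hg2
    rw [List.append_assoc] at hg hg0
    have hEi := D.ideal_append_subset α _ (of_elt_ne_zero hg0).1
    have hm := elt_mem_cutFilter h (key _ _ hg) hEi le_rfl hg
    have hE0 := elt_ne_zero hEi hEi (of_elt_ne_zero hg0).2.2
    refine ⟨_, hm, ?_, ?_⟩
    · exact (elt_le_elt hE0 (elt_ne_zero_of_le hC hAC hA0)).2
        ⟨ε, rfl, hE.trans (D.act_mono _ hAC)⟩
    · refine (elt_le_elt hE0 (elt_ne_zero_of_le hC' hAC' hA0')).2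
        ⟨ε', ?_, hE'.trans (D.act_mono _ hAC')⟩
      simpa using hε'

/-- The cut filter of a tight filter is tight. -/
theorem isTightFilter_cutFilter {ξ : Set D.Sgp} (h : IsTightFilter ξ) {α : List L} {γ : Word L}
    (hw : D.IsWordOf ξ (Word.append α γ)) : IsTightFilter (D.cutFilter α γ ξ) := by
  have hcut := isIdemFilter_cutFilter h.1 hw
  refine ⟨hcut, ?_⟩
  intro x hx Z hZ hcov
  constructor
  · rintro ⟨z, hzZ, hz⟩
    exact hcut.up z hz x hx (hcov.1 z hzZ).2
  intro hxm
  obtain ⟨δ, C, A, rfl, hδ, hC, hAC, hA⟩ := (mem_cutFilter h.1).1 hxm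
  have hA0 := ne_zero_of_mem h.1 hA
  have hx0 := elt_ne_zero_of_le hC hAC hA0
  -- the cover of `(αδ, A, αδ)` obtained by lifting the elements of `Z`
  let lift : D.Sgp → D.Sgp := fun z => match z with
    | .of p => D.elt (α ++ p.left) (p.set ⊓ D.act (p.left.drop δ.length) A) (α ++ p.left)
    | .zero => 0
  have lift_elt : ∀ ζ' E, D.elt (δ ++ ζ') E (δ ++ ζ') ≠ 0 →
      lift (D.elt (δ ++ ζ') E (δ ++ ζ')) =
        D.elt (α ++ (δ ++ ζ')) (E ⊓ D.act ζ' A) (α ++ (δ ++ ζ')) := by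
    intro ζ' E h0
    have h1 := of_elt_ne_zero h0
    have e1 : D.elt (δ ++ ζ') E (δ ++ ζ') = .of ⟨_, E, _, h1.1, h1.2.1, h1.2.2⟩ := dif_pos h1
    rw [e1]
    simp [lift]
  have form : ∀ z ∈ Z, z ≠ 0 → ∃ ζ' E, z = D.elt (δ ++ ζ') E (δ ++ ζ') := by
    intro z hz h0
    obtain ⟨hz1, hz2⟩ := hcov.1 z hz
    obtain ⟨ζ, E, rfl⟩ := exists_elt_of_idem h0 hz1
    obtain ⟨ζ', rfl, -⟩ := (elt_le_elt h0 hx0).1 hz2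
    exact ⟨ζ', E, rfl⟩
  have hcov' : IsCover (lift '' Z) (D.elt (α ++ δ) A (α ++ δ)) := by
    constructor
    · rintro _ ⟨z, hz, rfl⟩
      by_cases h0 : z = 0
      · subst h0
        exact ⟨zero_mul' _, zero_mul' _⟩
      obtain ⟨ζ', E, rfl⟩ := form z hz h0
      rw [lift_elt _ _ h0]
      refine ⟨elt_idem _ _, ?_⟩
      by_cases h1 : D.elt (α ++ (δ ++ ζ')) (E ⊓ D.act ζ' A) (α ++ (δ ++ ζ')) = 0
      · rw [h1, zero_mul']
      · exact (elt_le_elt h1 hA0).2 ⟨ζ', by simp, inf_le_right⟩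
    · intro y hy hyx hy0
      obtain ⟨ε', Y, rfl⟩ := exists_elt_of_idem hy0 hy
      obtain ⟨ε, rfl, hY⟩ := (elt_le_elt hy0 hA0).1 hyx
      rw [List.append_assoc] at hy hy0 hyx ⊢
      have hYi := (of_elt_ne_zero hy0).1
      have hYi' := D.ideal_append_subset α _ hYi
      have hy0' := elt_ne_zero hYi' hYi' (of_elt_ne_zero hy0).2.2
      obtain ⟨z, hz, hzy⟩ := hcov.2 (D.elt (δ ++ ε) Y (δ ++ ε)) (elt_idem _ _)
        ((elt_le_elt hy0' hx0).2 ⟨ε, rfl, hY.trans (D.act_mono _ hAC)⟩) hy0'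
      have hz0 : z ≠ 0 := by
        rintro rfl
        exact hzy (zero_mul' _)
      obtain ⟨ζ', E, rfl⟩ := form z hz hz0
      refine ⟨_, ⟨_, hz, rfl⟩, ?_⟩
      rw [lift_elt _ _ hz0]
      have hActA : D.act ζ' A ∈ D.ideal (α ++ (δ ++ ζ')) := by
        rw [← List.append_assoc]
        exact D.act_mem_ideal _ (of_elt_ne_zero hA0).1
      have hEi : E ⊓ D.act ζ' A ∈ D.ideal (α ++ (δ ++ ζ')) := D.ideal_lower inf_le_right hActA
      rcases comparable_of_mul_ne_zero hzy with hp | hp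
      · obtain ⟨κ, hκ⟩ := hp
        have hκ' : ε = ζ' ++ κ := by
          rw [List.append_assoc] at hκ
          exact (List.append_cancel_left hκ).symm
        subst hκ'
        rw [← List.append_assoc] at hzy hy0'
        rw [elt_mul_elt_append hz0 hy0'] at hzy
        have hne := (of_elt_ne_zero hzy).2.2
        rw [act_append] at hY
        have hne' : D.act κ (E ⊓ D.act ζ' A) ⊓ Y ≠ ⊥ := by
          rwa [act_inf, inf_assoc, inf_eq_right.2 hY]
        have hE0 : E ⊓ D.act ζ' A ≠ ⊥ := by
          intro h0
          rw [h0, act_bot, bot_inf_eq] at hne'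
          exact hne' rfl
        have e1 : α ++ (δ ++ (ζ' ++ κ)) = (α ++ (δ ++ ζ')) ++ κ := by simp
        rw [e1] at hy0 hYi ⊢
        rw [elt_mul_elt_append (elt_ne_zero hEi hEi hE0) hy0]
        exact elt_ne_zero (D.ideal_lower inf_le_right hYi) (D.ideal_lower inf_le_right hYi) hne'
      · obtain ⟨κ, hκ⟩ := hp
        have hκ' : ζ' = ε ++ κ := by
          rw [List.append_assoc] at hκ
          exact (List.append_cancel_left hκ).symm
        subst hκ'
        rw [← List.append_assoc] at hzy hz0
        rw [elt_append_mul_elt hz0 hy0'] at hzy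
        have hne := (of_elt_ne_zero hzy).2.2
        have hYA : D.act κ Y ≤ D.act (ε ++ κ) A := by
          rw [act_append]
          exact D.act_mono _ hY
        have hne' : (E ⊓ D.act (ε ++ κ) A) ⊓ D.act κ Y ≠ ⊥ := by
          rwa [inf_assoc, inf_eq_right.2 hYA]
        have hE0 : E ⊓ D.act (ε ++ κ) A ≠ ⊥ := by
          intro h0
          rw [h0, bot_inf_eq] at hne'
          exact hne' rfl
        have e1 : α ++ (δ ++ (ε ++ κ)) = (α ++ (δ ++ ε)) ++ κ := by simp
        rw [e1] at hEi ⊢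
        rw [elt_append_mul_elt (elt_ne_zero hEi hEi hE0) hy0]
        exact elt_ne_zero (D.ideal_lower inf_le_left hEi) (D.ideal_lower inf_le_left hEi) hne'
  obtain ⟨_, ⟨z, hz, rfl⟩, hzξ⟩ :=
    (h.2 _ (elt_idem _ _) _ (hZ.image lift) hcov').2 hA
  have hz0 : z ≠ 0 := by
    rintro rfl
    exact h.1.zero_notMem hzξ
  refine ⟨z, hz, ?_⟩
  obtain ⟨ζ', E, rfl⟩ := form z hz hz0
  rw [lift_elt _ _ hz0] at hzξ
  have hb := hw.1 _ _ hzξ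
  rw [List.length_append, Word.take_append] at hb
  exact elt_mem_cutFilter h.1 (List.append_cancel_left hb) (of_elt_ne_zero hz0).1 inf_le_left hzξ

theorem cutFilter_cutFilter {ξ : Set D.Sgp} (h : IsIdemFilter ξ) {α κ : List L} {γ : Word L}
    (hw : D.IsWordOf ξ (Word.append α (Word.append κ γ))) :
    D.cutFilter κ γ (D.cutFilter α (Word.append κ γ) ξ) = D.cutFilter (α ++ κ) γ ξ := by
  ext e
  rw [mem_cutFilter (isIdemFilter_cutFilter h hw), mem_cutFilter h]
  constructor
  · rintro ⟨δ, C, A, rfl, hδ, hC, hAC, hA⟩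
    obtain ⟨-, -, A', hA', hA'ξ⟩ := of_elt_mem_cutFilter h hA
    exact ⟨δ, C, A', rfl, hδ, hC, hA'.trans hAC, by rwa [List.append_assoc]⟩
  · rintro ⟨δ, C, A, rfl, hδ, hC, hAC, hA⟩
    rw [List.append_assoc] at hA
    refine ⟨δ, C, A, rfl, hδ, hC, hAC, elt_mem_cutFilter h ?_ ?_ le_rfl hA⟩
    · rw [List.length_append, Word.take_append, hδ]
    · exact D.ideal_append_subset α _ (of_elt_ne_zero (ne_zero_of_mem h hA)).1

/-- The cutting map `H_{[α]γ}` from the tight filters with word `αγ` to tight filters. -/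
def cut (α : List L) (γ : Word L) (ξ : D.T) (h : word ξ = Word.append α γ) : D.T :=
  ⟨D.cutFilter α γ ξ.1, isTightFilter_cutFilter ξ.2 (h ▸ isWordOf_word ξ)⟩

variable (D)

/-- The map `σ : T^{(1)} → T`, `σ(ξ) = H_{[a]γ}(ξ)` if `aγ` with `a ∈ L` is the word of `ξ`. -/
noncomputable def sigma (ξ : D.T1) : D.T :=
  cut [(Word.exists_cons ξ.2).choose.1] (Word.exists_cons ξ.2).choose.2 ξ.1
    (Word.exists_cons ξ.2).choose_spec

/-- The boundary path groupoid `Γ`: all triples `(η, |α| - |β|, ξ)` such that `η` and `ξ` have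
words of the form `αγ` and `βγ`, and `H_{[α]γ}(η) = H_{[β]γ}(ξ)`. -/
def boundaryPathGroupoid : TripleGroupoid D.T where
  carrier := {p | ∃ (α β : List L) (γ : Word L) (hη : word p.1 = Word.append α γ)
    (hξ : word p.2.2 = Word.append β γ), p.2.1 = (α.length : ℤ) - β.length ∧
      cut α γ p.1 hη = cut β γ p.2.2 hξ}
  unit_mem ξ := by
    have h : word ξ = Word.append [] (word ξ) := by
      cases word ξ <;> simp [Word.append]
    exact ⟨[], [], word ξ, h, h, by simp, rfl⟩
  mul_mem := by
    rintro η k ξ l ρ ⟨α, β, γ, hη, hξ, hk, he⟩ ⟨α', β', γ', hξ', hρ, hl, he'⟩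
    simp only at hη hξ hk he hξ' hρ hl he'
    have he1 : D.cutFilter α γ η.1 = D.cutFilter β γ ξ.1 := congrArg Subtype.val he
    have he2 : D.cutFilter α' γ' ξ.1 = D.cutFilter β' γ' ρ.1 := congrArg Subtype.val he'
    rcases le_total β.length α'.length with hle | hle
    · obtain ⟨κ, rfl, rfl⟩ := Word.append_eq_append (hξ ▸ hξ') hle
      refine ⟨α ++ κ, β', γ', by rw [Word.append_append]; exact hη, hρ, ?_, Subtype.ext ?_⟩
      · simp only [List.length_append] at hl ⊢
        push_cast at hl ⊢
        omega
      · change D.cutFilter (α ++ κ) γ' η.1 = D.cutFilter β' γ' ρ.1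
        rw [← he2, ← cutFilter_cutFilter η.2.1 (hη ▸ isWordOf_word η), he1,
          cutFilter_cutFilter ξ.2.1 (hξ ▸ isWordOf_word ξ)]
    · obtain ⟨κ, rfl, rfl⟩ := Word.append_eq_append (hξ' ▸ hξ) hle
      refine ⟨α, β' ++ κ, γ, hη, by rw [Word.append_append]; exact hρ, ?_, Subtype.ext ?_⟩
      · simp only [List.length_append] at hk ⊢
        push_cast at hk ⊢
        omega
      · change D.cutFilter α γ η.1 = D.cutFilter (β' ++ κ) γ ρ.1
        rw [he1, ← cutFilter_cutFilter ρ.2.1 (hρ ▸ isWordOf_word ρ), ← he2,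
          cutFilter_cutFilter ξ.2.1 (hξ' ▸ isWordOf_word ξ)]
  inv_mem := by
    rintro η k ξ ⟨α, β, γ, hη, hξ, hk, he⟩
    exact ⟨β, α, γ, hξ, hη, by simp only at hk ⊢; omega, he.symm⟩

end GBDS

/-!
The inverse semigroup `S` is faithfully represented by partial bijections of `L^* × B`: the element
`(α, A, β)` takes `(βδ, C)` to `(αδ, C)` for `∅ ≠ C ⊆ θ_δ(A)` (`GBDS.rel`). This gives the laws of
an inverse semigroup at once, and with them the action of `S` on its tight spectrum: `s` takes `ξ`
with `s^* s ∈ ξ` to the tight filter `s ξ = {e | s^* e s ∈ ξ}`, and this is a homeomorphism between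
the open sets of tight filters containing `s^* s` and `s s^*`.

Cutting and gluing are instances of this action. On the filters containing `(α, A, α)`, cutting `α`
is the translation by `(∅, A, α)` (`GBDS.cutFilter_eq_translate`), and gluing is inverse to cutting
(`GBDS.glueFilter_cutFilter`), so that a tight filter is determined by a finite beginning of its
word and what remains after cutting it. Therefore the translation by `(β, A, γ)` is cutting `γ`
followed by gluing `β` (`GBDS.translation_eq_glueFilter`). In particular `σ` is locally the
translation by an element `(∅, A, a)`, which makes it a local homeomorphism. Its powers are the
cutting maps (`GBDS.mem_partialPow_sigma`), which identifies `Γ` with the Renault–Deaconu groupoid.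

The bijection is `[s, ξ] ↦ (s ξ, |β| - |γ|, ξ)` for `s = (β, A, γ)`. If two elements of the same
degree translate `ξ` in the same way, the word of `ξ` forces their words to differ by a common
suffix, and then their germs at `ξ` agree (`GBDS.germ_elt_eq_germ_elt`). Conversely, filters which
agree after cutting `α` and `β` are related by some `(αδ, A, βδ)` (`GBDS.exists_elt_of_cut_eq`); the
suffix `δ` is needed because `ξ_0` may be empty. For the topologies, the basic set
`{[s, ξ] | ξ ∈ U}` is taken to the set `V(X, |β|, |γ|, U)`, where `X` consists of the filters
containing `s s^*` (`GBDS.mem_germ_image_iff`), and each `V(X, m, n, Y)` contains a neighbourhood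
of each of its points since `σ^m` and `σ^n` agree along the translation by `(αδ, A, βδ)` with
`|α| = m` and `|β| = n` (`GBDS.partialPow_sigma_translation`).
-/

/-! ### Inverse semigroups with zero acting on their tight spectra -/

/-- The laws of an inverse semigroup with zero whose inverse operation is `star`. -/
class IsInverseSemigroupWithZero (S : Type*) [Mul S] [Zero S] [Star S] : Prop where
  mul_assoc : ∀ s t u : S, s * t * u = s * (t * u)
  zero_mul : ∀ s : S, 0 * s = 0
  mul_zero : ∀ s : S, s * 0 = 0
  star_star : ∀ s : S, star (star s) = s
  star_mul : ∀ s t : S, star (s * t) = star t * star s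
  mul_star_mul : ∀ s : S, s * star s * s = s
  idem_comm : ∀ e f : S, e * e = e → f * f = f → e * f = f * e

namespace IsInverseSemigroupWithZero

variable {S : Type*} [Mul S] [Zero S] [Star S]

/-- The translate `s ξ` of a filter `ξ` in `E(S)`: the idempotents `e` with `s^* e s ∈ ξ`. If
`s^* s ∈ ξ`, this is the filter generated by `s ξ s^*`. -/
def translate (s : S) (ξ : Set S) : Set S := {e | e * e = e ∧ star s * e * s ∈ ξ}

variable [IsInverseSemigroupWithZero S]

theorem star_mul_star (s : S) : star s * s * star s = star s := by
  have := mul_star_mul (star s)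
  rwa [star_star] at this

theorem idem_star_mul (s : S) : (star s * s) * (star s * s) = star s * s := by
  rw [← mul_assoc, star_mul_star]

theorem idem_mul_star (s : S) : (s * star s) * (s * star s) = s * star s := by
  rw [← mul_assoc, mul_star_mul]

theorem star_idem {e : S} (he : e * e = e) : star e = e := by
  have h1 : star e * star e = star e := by rw [← star_mul, he]
  calc star e = star e * e * star e := (star_mul_star e).symm
    _ = star e * (e * e) * star e := by rw [he]
    _ = (star e * e) * (e * star e) := by simp only [mul_assoc]
    _ = (e * star e) * (star e * e) := idem_comm _ _ (idem_star_mul e) (idem_mul_star e)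
    _ = e * (star e * star e) * e := by simp only [mul_assoc]
    _ = e := by rw [h1, mul_star_mul]

theorem idem_mul {e f : S} (he : e * e = e) (hf : f * f = f) : (e * f) * (e * f) = e * f := by
  rw [mul_assoc, ← mul_assoc f, idem_comm f e hf he, mul_assoc e, hf, ← mul_assoc, he]

/-- Conjugation by `s` is multiplicative on idempotents. -/
theorem conj_mul (s : S) {e f : S} (he : e * e = e) :
    (star s * e * s) * (star s * f * s) = star s * (e * f) * s :=
  calc (star s * e * s) * (star s * f * s)
      = star s * (e * (s * star s)) * f * s := by simp only [mul_assoc]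
    _ = star s * ((s * star s) * e) * f * s := by rw [idem_comm e _ he (idem_mul_star s)]
    _ = (star s * s * star s) * (e * f) * s := by simp only [mul_assoc]
    _ = star s * (e * f) * s := by rw [star_mul_star]

theorem idem_conj (s : S) {e : S} (he : e * e = e) :
    (star s * e * s) * (star s * e * s) = star s * e * s := by rw [conj_mul s he, he]

theorem idem_conj_star (s : S) {e : S} (he : e * e = e) :
    (s * e * star s) * (s * e * star s) = s * e * star s := by
  have := idem_conj (star s) he
  rwa [star_star] at this

theorem mul_mem_filter {ξ : Set S} (h : IsIdemFilter ξ) {e f : S} (he : e ∈ ξ) (hf : f ∈ ξ) :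
    e * f ∈ ξ := by
  obtain ⟨g, hg, hge, hgf⟩ := h.directed e he f hf
  exact h.up g hg _ (idem_mul (h.idem e he) (h.idem f hf)) (by rw [← mul_assoc, hge, hgf])

theorem mem_of_mul_mem_left {ξ : Set S} (h : IsIdemFilter ξ) {e f : S} (he : e * e = e)
    (hf : f * f = f) (hef : e * f ∈ ξ) : e ∈ ξ := by
  refine h.up _ hef e he ?_
  rw [mul_assoc, idem_comm f e hf he, ← mul_assoc, he]

theorem mem_of_mul_mem_right {ξ : Set S} (h : IsIdemFilter ξ) {e f : S} (he : e * e = e)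
    (hf : f * f = f) (hef : e * f ∈ ξ) : f ∈ ξ := by
  rw [idem_comm e f he hf] at hef
  exact mem_of_mul_mem_left h hf he hef

theorem isIdemFilter_translate {ξ : Set S} (h : IsIdemFilter ξ) {s : S} (hs : star s * s ∈ ξ) :
    IsIdemFilter (translate s ξ) := by
  refine ⟨fun e he => he.1, ⟨s * star s, idem_mul_star s, ?_⟩, ?_, ?_, ?_⟩
  · rwa [← mul_assoc, star_mul_star]
  · rintro ⟨-, h0⟩
    rw [mul_zero, zero_mul] at h0
    exact h.zero_notMem h0
  · rintro e ⟨he, heξ⟩ f hf hef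
    refine ⟨hf, h.up _ heξ _ (idem_conj s hf) ?_⟩
    rw [conj_mul s he, hef]
  · rintro e ⟨he, heξ⟩ f ⟨hf, hfξ⟩
    refine ⟨e * f, ⟨idem_mul he hf, ?_⟩, ?_, ?_⟩
    · rw [← conj_mul s he]
      exact mul_mem_filter h heξ hfξ
    · rw [mul_assoc, idem_comm f e hf he, ← mul_assoc, he]
    · rw [mul_assoc, hf]

/-- Conjugation by `s` takes covers of `x` to covers of `s^* x s`, so translates of tight filters
are tight. -/
theorem isTightFilter_translate {ξ : Set S} (h : IsTightFilter ξ) {s : S} (hs : star s * s ∈ ξ) :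
    IsTightFilter (translate s ξ) := by
  have hf := isIdemFilter_translate h.1 hs
  refine ⟨hf, fun x hx Z hZ hcov => ⟨?_, ?_⟩⟩
  · rintro ⟨z, hzZ, hz⟩
    exact hf.up z hz x hx (hcov.1 z hzZ).2
  rintro ⟨-, hxξ⟩
  have hcov' : IsCover ((fun z => star s * z * s) '' Z) (star s * x * s) := by
    constructor
    · rintro _ ⟨z, hz, rfl⟩
      obtain ⟨hz1, hz2⟩ := hcov.1 z hz
      exact ⟨idem_conj s hz1, by rw [conj_mul s hz1, hz2]⟩
    · intro y hy hyx hy0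
      have hyx' : y * (star s * s) = y := by
        conv_lhs => rw [← hyx]
        rw [mul_assoc, mul_assoc _ s, ← mul_assoc s, mul_star_mul, hyx]
      have hback : star s * (s * y * star s) * s = y :=
        calc star s * (s * y * star s) * s = (star s * s) * (y * (star s * s)) := by
              simp only [mul_assoc]
          _ = y := by rw [hyx', idem_comm _ y (idem_star_mul s) hy, hyx']
      obtain ⟨z, hz, hzy⟩ := hcov.2 (s * y * star s) (idem_conj_star s hy)
        (by
          conv_rhs => rw [← hyx]
          calc s * y * star s * x = s * y * (star s * s * star s) * x := by rw [star_mul_star]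
            _ = s * y * star s * ((s * star s) * x) := by simp only [mul_assoc]
            _ = s * y * star s * (x * (s * star s)) := by
              rw [idem_comm _ x (idem_mul_star s) hx]
            _ = s * (y * (star s * x * s)) * star s := by simp only [mul_assoc])
        (by
          intro h0
          rw [h0, mul_zero, zero_mul] at hback
          exact hy0 hback.symm)
      refine ⟨_, ⟨z, hz, rfl⟩, fun h0 => hzy ?_⟩
      calc z * (s * y * star s) = z * ((s * star s * s) * y * star s) := by rw [mul_star_mul]
        _ = (z * (s * star s)) * (s * y * star s) := by simp only [mul_assoc]
        _ = ((s * star s) * z) * (s * y * star s) := by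
          rw [idem_comm z _ (hcov.1 z hz).1 (idem_mul_star s)]
        _ = s * (star s * z * s * y) * star s := by simp only [mul_assoc]
        _ = 0 := by rw [h0, mul_zero, zero_mul]
  obtain ⟨_, ⟨z, hz, rfl⟩, hzξ⟩ := (h.2 _ (idem_conj s hx) _ (hZ.image _) hcov').2 hxξ
  exact ⟨z, hz, (hcov.1 z hz).1, hzξ⟩

theorem translate_translate (s t : S) (ξ : Set S) :
    translate t (translate s ξ) = translate (t * s) ξ := by
  ext e
  have key : star s * (star t * e * t) * s = star (t * s) * e * (t * s) := by
    rw [star_mul]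
    simp only [mul_assoc]
  constructor
  · rintro ⟨he, -, h⟩
    exact ⟨he, key ▸ h⟩
  · rintro ⟨he, h⟩
    exact ⟨he, idem_conj t he, key.symm ▸ h⟩

theorem translate_idem {ξ : Set S} (h : IsIdemFilter ξ) {e : S} (he : e ∈ ξ) :
    translate e ξ = ξ := by
  have he' := h.idem e he
  ext f
  constructor
  · rintro ⟨hf, h'⟩
    rw [star_idem he'] at h'
    exact mem_of_mul_mem_right h he' hf
      (mem_of_mul_mem_left h (idem_mul he' hf) he' h')
  · intro hf
    refine ⟨h.idem f hf, ?_⟩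
    rw [star_idem he']
    exact mul_mem_filter h (mul_mem_filter h he hf) he

/-- The translate `s ξ` depends on the germ of `s` at `ξ` only. -/
theorem translate_congr {ξ : Set S} (h : IsIdemFilter ξ) {s t e : S} (he : e ∈ ξ)
    (hst : s * e = t * e) : translate s ξ = translate t ξ := by
  rw [← translate_idem h he, translate_translate, translate_translate, hst]

/-- The translation `ξ ↦ s ξ` on the tight filters containing `s^* s`. -/
def translation (s : S) (ξ : TightSpectrum S) (h : star s * s ∈ ξ.1) : TightSpectrum S :=
  ⟨translate s ξ.1, isTightFilter_translate ξ.2 h⟩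

theorem mul_star_mem_translate {ξ : Set S} {s : S} (h : star s * s ∈ ξ) :
    s * star s ∈ translate s ξ :=
  ⟨idem_mul_star s, by rwa [← mul_assoc, star_mul_star]⟩

end IsInverseSemigroupWithZero

namespace TightSpectrum

open IsInverseSemigroupWithZero

variable {S : Type*} [Mul S] [Zero S]

theorem isClopen_mem (e : S) : IsClopen {ξ : TightSpectrum S | e ∈ ξ.1} := by
  by_cases he : e * e = e
  · have h : Continuous fun ξ : TightSpectrum S => ξ.character ⟨e, he⟩ :=
      (continuous_apply (⟨e, he⟩ : {e : S // e * e = e})).comp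
        (continuous_induced_dom (f := character (S := S)))
    have h' : {ξ : TightSpectrum S | e ∈ ξ.1} =
        (fun ξ : TightSpectrum S => ξ.character ⟨e, he⟩) ⁻¹' {true} := by
      ext ξ
      simp [character]
    rw [h']
    exact (isClopen_discrete _).preimage h
  · have : {ξ : TightSpectrum S | e ∈ ξ.1} = ∅ :=
      Set.eq_empty_iff_forall_notMem.2 fun ξ hξ => he (ξ.2.1.idem e hξ)
    rw [this]
    exact isClopen_empty

/-- A map into the tight spectrum is continuous as soon as it pulls back each set
`{ξ | e ∈ ξ}` to a clopen set. -/
theorem continuous_of_isClopen {X : Type*} [TopologicalSpace X] {f : X → TightSpectrum S}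
    (h : ∀ e : S, e * e = e → IsClopen {x | e ∈ (f x).1}) : Continuous f := by
  refine continuous_induced_rng.2 (continuous_pi fun e => ?_)
  refine continuous_discrete_rng.2 fun b => ?_
  cases b
  · convert (h e.1 e.2).compl.isOpen using 1
    ext x
    simp [character]
  · convert (h e.1 e.2).isOpen using 1
    ext x
    simp [character]

variable [Star S] [IsInverseSemigroupWithZero S]

theorem continuous_translation (s : S) :
    Continuous fun ξ : {ξ : TightSpectrum S // star s * s ∈ ξ.1} => translation s ξ.1 ξ.2 := by
  refine continuous_of_isClopen fun e he => ?_
  convert (isClopen_mem (star s * e * s)).preimage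
    (continuous_subtype_val (p := fun ξ : TightSpectrum S => star s * s ∈ ξ.1)) using 1
  ext ξ
  exact ⟨fun h => h.2, fun h => ⟨he, h⟩⟩

theorem isOpen_translation_preimage (s : S) {X : Set (TightSpectrum S)} (hX : IsOpen X) :
    IsOpen {ξ : TightSpectrum S | ∃ h : star s * s ∈ ξ.1, translation s ξ h ∈ X} := by
  have h1 := (isClopen_mem (star s * s)).isOpen.isOpenEmbedding_subtypeVal.isOpenMap _
    (hX.preimage (continuous_translation s))
  convert h1 using 1
  ext ξ
  simp only [Set.mem_ofPred_eq, Set.mem_image, Set.mem_preimage, Subtype.exists, exists_and_right,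
    exists_eq_right]

end TightSpectrum

namespace IsInverseSemigroupWithZero

variable {S : Type*} [Mul S] [Zero S] [Star S] [IsInverseSemigroupWithZero S]

theorem star_mul_mem_translation (s : S) (ξ : TightSpectrum S) (h : star s * s ∈ ξ.1) :
    star (star s) * star s ∈ (translation s ξ h).1 := by
  rw [star_star]
  exact mul_star_mem_translate h

theorem translation_star_translation (s : S) (ξ : TightSpectrum S) (h : star s * s ∈ ξ.1) :
    translation (star s) (translation s ξ h) (star_mul_mem_translation s ξ h) = ξ :=
  Subtype.ext <| (translate_translate s (star s) ξ.1).trans (translate_idem ξ.2.1 h)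

theorem translation_translation_star (s : S) (ξ : TightSpectrum S)
    (h : star (star s) * star s ∈ ξ.1)
    (h' : star s * s ∈ (translation (star s) ξ h).1) :
    translation s (translation (star s) ξ h) h' = ξ := by
  refine Subtype.ext <| (translate_translate (star s) s ξ.1).trans (translate_idem ξ.2.1 ?_)
  rwa [star_star] at h

/-- Translation by `s` takes open subsets of `{ξ | s^* s ∈ ξ}` to open sets. -/
theorem isOpen_translation_image (s : S) {U : Set (TightSpectrum S)} (hU : IsOpen U) :
    IsOpen {η : TightSpectrum S | ∃ ξ ∈ U, ∃ h : star s * s ∈ ξ.1, η = translation s ξ h} := by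
  convert TightSpectrum.isOpen_translation_preimage (star s) hU using 1
  ext η
  constructor
  · rintro ⟨ξ, hξ, h, rfl⟩
    exact ⟨star_mul_mem_translation s ξ h, by rwa [translation_star_translation]⟩
  · rintro ⟨h, hη⟩
    have h' : star s * s ∈ (translation (star s) η h).1 := by
      have := star_mul_mem_translation (star s) η h
      rwa [star_star s] at this
    exact ⟨_, hη, h', (translation_translation_star s η h h').symm⟩

end IsInverseSemigroupWithZero

/-! ### The inverse semigroup of a generalized Boolean dynamical system -/

namespace GBDS

variable {B L : Type*} [GeneralizedBooleanAlgebra B] {D : GBDS B L}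

/-- The faithful representation of `S` by partial bijections of `L^* × B`: the element
`(α, A, β)` takes `(βδ, C)` to `(αδ, C)` whenever `∅ ≠ C ⊆ θ_δ(A)`, and `0` is nowhere defined. -/
def rel : D.Sgp → List L × B → List L × B → Prop
  | .of p, x, y => ∃ δ, x.1 = p.right ++ δ ∧ y.1 = p.left ++ δ ∧ x.2 = y.2 ∧
      x.2 ≤ D.act δ p.set ∧ x.2 ≠ ⊥
  | .zero, _, _ => False

theorem rel_zero (x y : List L × B) : ¬ rel (0 : D.Sgp) x y := id

theorem rel_elt {α β : List L} {A : B} (h : D.elt α A β ≠ 0) (x y : List L × B) :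
    rel (D.elt α A β) x y ↔ ∃ δ, x.1 = β ++ δ ∧ y.1 = α ++ δ ∧ x.2 = y.2 ∧
      x.2 ≤ D.act δ A ∧ x.2 ≠ ⊥ := by
  have e : D.elt α A β = .of ⟨α, A, β, _, _, _⟩ := dif_pos (of_elt_ne_zero h)
  rw [e]
  rfl

/-- For `A` in both ideals, the description of `rel` holds also if `A = ∅`. -/
theorem rel_elt' {α β : List L} {A : B} (h1 : A ∈ D.ideal α) (h2 : A ∈ D.ideal β)
    (x y : List L × B) :
    rel (D.elt α A β) x y ↔ ∃ δ, x.1 = β ++ δ ∧ y.1 = α ++ δ ∧ x.2 = y.2 ∧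
      x.2 ≤ D.act δ A ∧ x.2 ≠ ⊥ := by
  by_cases hA : A = ⊥
  · rw [elt_eq_zero (fun h => h.2.2 hA)]
    refine ⟨fun h => (rel_zero _ _ h).elim, ?_⟩
    rintro ⟨δ, -, -, -, h, h0⟩
    rw [hA, act_bot] at h
    exact (h0 (le_bot_iff.1 h)).elim
  · exact rel_elt (elt_ne_zero h1 h2 hA) x y

theorem rel_mul (s t : D.Sgp) (x z : List L × B) :
    rel (s * t) x z ↔ ∃ y, rel t x y ∧ rel s y z := by
  by_cases hs : s = 0
  · subst hs
    rw [zero_mul']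
    exact ⟨fun h => (rel_zero _ _ h).elim, fun ⟨y, _, h⟩ => (rel_zero _ _ h).elim⟩
  by_cases ht : t = 0
  · subst ht
    rw [mul_zero']
    exact ⟨fun h => (rel_zero _ _ h).elim, fun ⟨y, h, _⟩ => (rel_zero _ _ h).elim⟩
  obtain ⟨α, A, β, rfl⟩ := exists_elt s hs
  obtain ⟨γ, C, δ, rfl⟩ := exists_elt t ht
  have hs' := of_elt_ne_zero hs
  have ht' := of_elt_ne_zero ht
  obtain ⟨x, E⟩ := x
  obtain ⟨z, G⟩ := z
  have hcomp : (∃ y, rel (D.elt γ C δ) (x, E) y ∧ rel (D.elt α A β) y (z, G)) ↔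
      ∃ ε κ, x = δ ++ ε ∧ γ ++ ε = β ++ κ ∧ z = α ++ κ ∧ E = G ∧ E ≤ D.act ε C ∧
        E ≤ D.act κ A ∧ E ≠ ⊥ := by
    simp only [rel_elt hs, rel_elt ht, Prod.exists]
    constructor
    · rintro ⟨y, F, ⟨ε, rfl, rfl, rfl, h1, h2⟩, ⟨κ, h3, rfl, rfl, h4, -⟩⟩
      exact ⟨ε, κ, rfl, h3, rfl, rfl, h1, h4, h2⟩
    · rintro ⟨ε, κ, rfl, h3, rfl, rfl, h1, h4, h2⟩
      exact ⟨γ ++ ε, E, ⟨ε, rfl, rfl, rfl, h1, h2⟩, ⟨κ, h3, rfl, rfl, h4, h2⟩⟩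
  rw [hcomp]
  by_cases h1 : β <+: γ
  · obtain ⟨γ', rfl⟩ := h1
    rw [elt_mul_elt_append hs ht, rel_elt'
      (D.ideal_lower inf_le_left (D.act_mem_ideal _ hs'.1)) (D.ideal_lower inf_le_right ht'.2.1)]
    simp only [act_inf, le_inf_iff, ← act_append]
    constructor
    · rintro ⟨ε, rfl, rfl, rfl, ⟨h2, h3⟩, h4⟩
      exact ⟨ε, γ' ++ ε, rfl, by simp, by simp, rfl, h3, h2, h4⟩
    · rintro ⟨ε, κ, rfl, h, rfl, rfl, h2, h3, h4⟩
      rw [List.append_assoc] at h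
      obtain rfl := List.append_cancel_left h
      exact ⟨ε, rfl, by simp, rfl, ⟨h3, h2⟩, h4⟩
  by_cases h2 : γ <+: β
  · obtain ⟨β', rfl⟩ := h2
    rw [elt_append_mul_elt hs ht, rel_elt' (D.ideal_lower inf_le_left hs'.1)
      (D.ideal_lower inf_le_right (D.act_mem_ideal _ ht'.2.1))]
    simp only [act_inf, le_inf_iff, ← act_append]
    constructor
    · rintro ⟨ε, rfl, rfl, rfl, ⟨h2, h3⟩, h4⟩
      exact ⟨β' ++ ε, ε, by simp, by simp, rfl, rfl, h3, h2, h4⟩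
    · rintro ⟨ε, κ, rfl, h, rfl, rfl, h2, h3, h4⟩
      rw [List.append_assoc] at h
      obtain rfl := List.append_cancel_left h
      exact ⟨κ, by simp, rfl, rfl, ⟨h3, h2⟩, h4⟩
  · rw [elt_mul_elt hs ht, if_neg h1, if_neg h2]
    refine ⟨fun h => (rel_zero _ _ h).elim, ?_⟩
    rintro ⟨ε, κ, -, h, -⟩
    exfalso
    rcases le_total β.length γ.length with hl | hl
    · exact h1 (List.prefix_of_prefix_length_le ⟨κ, h.symm⟩ ⟨ε, rfl⟩ hl)
    · exact h2 (List.prefix_of_prefix_length_le ⟨ε, h⟩ ⟨κ, rfl⟩ hl)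

theorem rel_star (s : D.Sgp) (x y : List L × B) : rel (star s) x y ↔ rel s y x := by
  cases s with
  | zero => exact Iff.rfl
  | of p =>
    constructor
    · rintro ⟨δ, h1, h2, h3, h4, h5⟩
      exact ⟨δ, h2, h1, h3.symm, h3 ▸ h4, h3 ▸ h5⟩
    · rintro ⟨δ, h1, h2, h3, h4, h5⟩
      exact ⟨δ, h2, h1, h3.symm, h3 ▸ h4, h3 ▸ h5⟩

theorem rel_right_unique {s : D.Sgp} {x y z : List L × B} (h1 : rel s x y) (h2 : rel s x z) :
    y = z := by
  cases s with
  | zero => exact h1.elim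
  | of p =>
    obtain ⟨δ, h3, h4, h5, -⟩ := h1
    obtain ⟨δ', h3', h4', h5', -⟩ := h2
    obtain rfl := List.append_cancel_left (h3.symm.trans h3')
    exact Prod.ext (h4.trans h4'.symm) (h5.symm.trans h5')

theorem rel_left_unique {s : D.Sgp} {x y z : List L × B} (h1 : rel s x z) (h2 : rel s y z) :
    x = y :=
  rel_right_unique ((rel_star s _ _).2 h1) ((rel_star s _ _).2 h2)

theorem rel_elt_self {α β : List L} {A : B} (h : D.elt α A β ≠ 0) :
    rel (D.elt α A β) (β, A) (α, A) :=
  (rel_elt h _ _).2 ⟨[], by simp, by simp, rfl, le_rfl, (of_elt_ne_zero h).2.2⟩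

theorem exists_rel {s : D.Sgp} (h : s ≠ 0) : ∃ x y, rel s x y := by
  obtain ⟨α, A, β, rfl⟩ := exists_elt s h
  exact ⟨_, _, rel_elt_self h⟩

/-- The representation by partial bijections is faithful. -/
theorem rel_injective {s t : D.Sgp} (h : ∀ x y, rel s x y ↔ rel t x y) : s = t := by
  by_cases hs : s = 0
  · by_contra hne
    obtain ⟨x, y, hxy⟩ := exists_rel (fun ht => hne (hs.trans ht.symm))
    rw [← h, hs] at hxy
    exact hxy
  by_cases ht : t = 0
  · obtain ⟨x, y, hxy⟩ := exists_rel hs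
    rw [h, ht] at hxy
    exact hxy.elim
  obtain ⟨α, A, β, rfl⟩ := exists_elt s hs
  obtain ⟨γ, C, δ, rfl⟩ := exists_elt t ht
  obtain ⟨ε, h1, h2, -, h3, -⟩ := (rel_elt ht _ _).1 ((h _ _).1 (rel_elt_self hs))
  obtain ⟨ε', h1', -, -, h3', -⟩ := (rel_elt hs _ _).1 ((h _ _).2 (rel_elt_self ht))
  have hε : ε = [] := by
    have e1 := congrArg List.length h1
    have e2 := congrArg List.length h1'
    simp only [List.length_append] at e1 e2
    exact List.length_eq_zero_iff.1 (by omega)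
  have hε' : ε' = [] := by
    have e1 := congrArg List.length h1
    have e2 := congrArg List.length h1'
    simp only [List.length_append] at e1 e2
    exact List.length_eq_zero_iff.1 (by omega)
  subst hε hε'
  simp only [List.append_nil] at h1 h2
  obtain rfl := h1
  obtain rfl := h2
  obtain rfl : A = C := le_antisymm h3 h3'
  rfl

theorem eq_of_rel_of_idem {e : D.Sgp} (he : e * e = e) {x y : List L × B} (h : rel e x y) :
    x = y := by
  have h' := h
  rw [← he, rel_mul] at h'
  obtain ⟨z, h1, h2⟩ := h'
  obtain rfl := rel_right_unique h h1
  exact rel_left_unique h h2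

instance : IsInverseSemigroupWithZero D.Sgp where
  mul_assoc s t u := rel_injective fun x y => by
    simp only [rel_mul]
    constructor
    · rintro ⟨z, h1, w, h2, h3⟩
      exact ⟨w, ⟨z, h1, h2⟩, h3⟩
    · rintro ⟨w, ⟨z, h1, h2⟩, h3⟩
      exact ⟨z, h1, w, h2, h3⟩
  zero_mul := zero_mul'
  mul_zero := mul_zero'
  star_star s := rel_injective fun x y => by rw [rel_star, rel_star]
  star_mul s t := rel_injective fun x y => by
    simp only [rel_star, rel_mul]
    exact exists_congr fun z => and_comm
  mul_star_mul s := rel_injective fun x y => by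
    simp only [rel_star, rel_mul]
    constructor
    · rintro ⟨z, h1, w, h2, h3⟩
      rwa [rel_left_unique h1 h2]
    · intro h
      exact ⟨y, h, x, h, h⟩
  idem_comm e f he hf := rel_injective fun x y => by
    simp only [rel_mul]
    constructor
    · rintro ⟨z, h1, h2⟩
      obtain rfl := eq_of_rel_of_idem hf h1
      obtain rfl := eq_of_rel_of_idem he h2
      exact ⟨_, h2, h1⟩
    · rintro ⟨z, h1, h2⟩
      obtain rfl := eq_of_rel_of_idem he h1
      obtain rfl := eq_of_rel_of_idem hf h2
      exact ⟨_, h2, h1⟩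

/-- The degree `|α| - |β|` of `(α, A, β)`; the value at `0` is immaterial. -/
def degree : D.Sgp → ℤ
  | .of p => (p.left.length : ℤ) - p.right.length
  | .zero => 0

theorem degree_elt {α β : List L} {A : B} (h : D.elt α A β ≠ 0) :
    degree (D.elt α A β) = (α.length : ℤ) - β.length := by
  have e : D.elt α A β = .of ⟨α, A, β, _, _, _⟩ := dif_pos (of_elt_ne_zero h)
  rw [e]
  rfl

theorem degree_of_rel {s : D.Sgp} {x y : List L × B} (h : rel s x y) :
    degree s = (y.1.length : ℤ) - x.1.length := by
  cases s with
  | zero => exact h.elim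
  | of p =>
    obtain ⟨δ, h1, h2, -⟩ := h
    rw [h1, h2]
    simp only [degree, List.length_append]
    push_cast
    ring

/-- The degree of `s` is determined by any non-zero product of `s` with an idempotent. -/
theorem degree_congr {s t e : D.Sgp} (he : e * e = e) (h : s * e = t * e) (h0 : s * e ≠ 0) :
    degree s = degree t := by
  obtain ⟨x, y, hxy⟩ := exists_rel h0
  have hxy' := hxy
  rw [h] at hxy'
  obtain ⟨z, h1, h2⟩ := (rel_mul _ _ _ _).1 hxy
  obtain ⟨w, h3, h4⟩ := (rel_mul _ _ _ _).1 hxy'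
  obtain rfl := eq_of_rel_of_idem he h1
  obtain rfl := eq_of_rel_of_idem he h3
  rw [degree_of_rel h2, degree_of_rel h4]

theorem star_elt (α : List L) (A : B) (β : List L) : star (D.elt α A β) = D.elt β A α := by
  by_cases h : D.elt α A β = 0
  · rw [h]
    refine (elt_eq_zero fun h' => ?_).symm
    exact elt_ne_zero h'.2.1 h'.1 h'.2.2 h
  · have h' := of_elt_ne_zero h
    have e : D.elt α A β = .of ⟨α, A, β, h'.1, h'.2.1, h'.2.2⟩ := dif_pos h'
    have e' : D.elt β A α = .of ⟨β, A, α, h'.2.1, h'.1, h'.2.2⟩ := dif_pos ⟨h'.2.1, h'.1, h'.2.2⟩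
    rw [e, e']
    rfl

theorem elt_mul_elt_same {α β γ : List L} {A : B} (h1 : D.elt α A β ≠ 0)
    (h2 : D.elt β A γ ≠ 0) : D.elt α A β * D.elt β A γ = D.elt α A γ := by
  have := elt_mul_elt_append (γ' := []) h1 (by simpa using h2)
  simpa [act] using this

/-- Conjugating `(δ, C, δ)` by `(α, A, ∅)`. -/
theorem conj_elt {α δ : List L} {A C : B} (hA : D.elt α A α ≠ 0) (hC : D.elt δ C δ ≠ 0) :
    D.elt α A [] * D.elt δ C δ * D.elt [] A α =
      D.elt (α ++ δ) (D.act δ A ⊓ C) (α ++ δ) := by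
  have hA' := of_elt_ne_zero hA
  have h1 : D.elt α A [] ≠ 0 := elt_ne_zero hA'.1 trivial hA'.2.2
  have h2 : D.elt [] A α ≠ 0 := elt_ne_zero trivial hA'.1 hA'.2.2
  have e1 : D.elt α A [] * D.elt δ C δ = D.elt (α ++ δ) (D.act δ A ⊓ C) δ :=
    elt_mul_elt_append (β := []) h1 hC
  rw [e1]
  by_cases h0 : D.act δ A ⊓ C = ⊥
  · rw [elt_eq_zero fun h => h.2.2 h0, zero_mul', elt_eq_zero fun h => h.2.2 h0]
  · have h3 : D.elt (α ++ δ) (D.act δ A ⊓ C) ([] ++ δ) ≠ 0 :=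
      elt_ne_zero (D.ideal_lower inf_le_left (D.act_mem_ideal _ hA'.1))
        (D.ideal_lower inf_le_right (of_elt_ne_zero hC).1) h0
    have e2 := elt_append_mul_elt h3 h2
    rw [inf_right_comm, inf_idem] at e2
    exact e2

end GBDS

/-! ### Words of filters -/

namespace Word

variable {L : Type*}

theorem take_take_of_le (ω : Word L) {i m : ℕ} (h : i ≤ m) : (ω.take m).take i = ω.take i := by
  cases ω with
  | fin w => simp [take, List.take_take, h]
  | inf x => simp [take, ← List.map_take, List.take_range, h]

theorem take_length_take (ω : Word L) (n : ℕ) : ω.take (ω.take n).length = ω.take n := by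
  cases ω with
  | fin w => simp only [take, List.length_take, ← List.take_eq_take_min]
  | inf x => simp [take]

theorem ext_take {ω ω' : Word L} (hl : ω.length = ω'.length)
    (h : ∀ n : ℕ, (n : ℕ∞) ≤ ω.length → ω.take n = ω'.take n) : ω = ω' := by
  cases ω with
  | fin w =>
    cases ω' with
    | fin w' =>
      simp only [length, Nat.cast_inj] at hl
      have := h w.length le_rfl
      simp only [take, List.take_length] at this
      rw [hl, List.take_length] at this
      rw [this]
    | inf x => simp [length] at hl
  | inf x =>
    cases ω' with
    | fin w' => simp [length] at hl
    | inf x' =>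
      congr 1
      funext n
      have := h (n + 1) le_top
      simpa [take, List.range_succ] using (congrArg List.getLast? this)

theorem add_le_length_append {α : List L} {γ : Word L} {n : ℕ} (h : (n : ℕ∞) ≤ γ.length) :
    ((α.length + n : ℕ) : ℕ∞) ≤ (append α γ).length := by
  cases γ with
  | fin w =>
    simp only [length, append, List.length_append, Nat.cast_le] at h ⊢
    omega
  | inf x => exact le_top

theorem nil_append (ω : Word L) : append [] ω = ω := by
  cases ω <;> simp [append]

/-- A finite beginning of a word splits off. -/
theorem exists_eq_append {ω : Word L} {β : List L} (h : ω.take β.length = β) :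
    ∃ γ, ω = append β γ := by
  cases ω with
  | fin w =>
    refine ⟨fin (w.drop β.length), ?_⟩
    have h' : w.take β.length = β := h
    simp only [append, fin.injEq]
    have h'' := List.take_append_drop β.length w
    rw [h'] at h''
    exact h''.symm
  | inf x =>
    refine ⟨inf fun n => x (β.length + n), ?_⟩
    have h' : (List.range β.length).map x = β := h
    simp only [append, inf.injEq]
    funext n
    by_cases hn : n < β.length
    · conv_rhs => rw [← h']
      simp [hn]
    · have hn' : β.length ≤ n := by omega
      simp [List.getElem?_eq_none hn', Nat.add_sub_cancel' hn']

end Word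

namespace GBDS

open IsInverseSemigroupWithZero

variable {B L : Type*} [GeneralizedBooleanAlgebra B] {D : GBDS B L}

theorem IsWordOf.unique {ξ : Set D.Sgp} {ω ω' : Word L} (h : D.IsWordOf ξ ω)
    (h' : D.IsWordOf ξ ω') : ω = ω' := by
  have key : ∀ {ω₁ ω₂ : Word L}, D.IsWordOf ξ ω₁ → D.IsWordOf ξ ω₂ → ∀ n : ℕ,
      (n : ℕ∞) ≤ ω₁.length → (n : ℕ∞) ≤ ω₂.length ∧ ω₁.take n = ω₂.take n := by
    intro ω₁ ω₂ h₁ h₂ n hn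
    obtain ⟨β, A, hA, hl⟩ := h₁.2 n hn
    refine ⟨le_trans (Nat.cast_le.2 hl) (Word.beginning_le (h₂.1 _ _ hA)), ?_⟩
    rw [← Word.take_take_of_le ω₁ hl, ← Word.take_take_of_le ω₂ hl, h₁.1 _ _ hA, h₂.1 _ _ hA]
  exact Word.ext_take (le_antisymm (ENat.forall_natCast_le_iff_le.1 fun n hn => (key h h' n hn).1)
    (ENat.forall_natCast_le_iff_le.1 fun n hn => (key h' h n hn).1)) fun n hn => (key h h' n hn).2

theorem word_eq {ξ : D.T} {ω : Word L} (h : D.IsWordOf ξ.1 ω) : word ξ = ω :=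
  (isWordOf_word ξ).unique h

theorem exists_elt_append_mem {ξ : Set D.Sgp} {α : List L} {γ : Word L}
    (hw : D.IsWordOf ξ (Word.append α γ)) {n : ℕ} (hn : (n : ℕ∞) ≤ γ.length) :
    ∃ δ A, D.elt (α ++ δ) A (α ++ δ) ∈ ξ ∧ γ.take δ.length = δ ∧ n ≤ δ.length := by
  obtain ⟨β, A, hA, hl⟩ := hw.2 (α.length + n) (Word.add_le_length_append hn)
  obtain ⟨k, hk⟩ := Nat.exists_eq_add_of_le ((Nat.le_add_right _ _).trans hl)
  have hβ := hw.1 _ _ hA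
  rw [hk, Word.take_append] at hβ
  rw [← hβ] at hA
  refine ⟨γ.take k, A, hA, Word.take_length_take γ k, ?_⟩
  have := congrArg List.length hβ
  rw [List.length_append] at this
  omega

theorem isWordOf_cutFilter {ξ : Set D.Sgp} (h : IsIdemFilter ξ) {α : List L} {γ : Word L}
    (hw : D.IsWordOf ξ (Word.append α γ)) : D.IsWordOf (D.cutFilter α γ ξ) γ := by
  refine ⟨fun β A hA => (of_elt_mem_cutFilter h hA).1, fun n hn => ?_⟩
  obtain ⟨δ, A, hA, hδ, hl⟩ := exists_elt_append_mem hw hn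
  exact ⟨δ, A, elt_mem_cutFilter h hδ
    (D.ideal_append_subset α _ (of_elt_ne_zero (ne_zero_of_mem h hA)).1) le_rfl hA, hl⟩

theorem word_cut {ξ : D.T} {α : List L} {γ : Word L} (h : word ξ = Word.append α γ) :
    word (cut α γ ξ h) = γ :=
  word_eq (isWordOf_cutFilter ξ.2.1 (h ▸ isWordOf_word ξ))

/-- A tight filter containing `(β, A, β)` has a word with beginning `β`. -/
theorem exists_word_eq_append {ξ : D.T} {β : List L} {A : B} (h : D.elt β A β ∈ ξ.1) :
    ∃ γ, word ξ = Word.append β γ :=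
  Word.exists_eq_append ((isWordOf_word ξ).1 β A h)

/-! ### Gluing inverts cutting -/

theorem mem_family {ξ : Set D.Sgp} (h : IsIdemFilter ξ) {ω : Word L} {n : ℕ} {A : B} :
    A ∈ D.family ξ ω n ↔ D.elt (ω.take n) A (ω.take n) ∈ ξ :=
  ⟨fun hA => hA.2, fun hA => ⟨(of_elt_ne_zero (ne_zero_of_mem h hA)).1, hA⟩⟩

/-- In a filter, the intersection of `(α, A, α)` and `(αδ, C, αδ)` is `(αδ, θ_δ(A) ∩ C, αδ)`. -/
theorem elt_inf_mem {ξ : Set D.Sgp} (h : IsIdemFilter ξ) {α δ : List L} {A C : B}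
    (hA : D.elt α A α ∈ ξ) (hC : D.elt (α ++ δ) C (α ++ δ) ∈ ξ) :
    D.elt (α ++ δ) (D.act δ A ⊓ C) (α ++ δ) ∈ ξ := by
  have := mul_mem_filter h hA hC
  rwa [elt_mul_elt_append (ne_zero_of_mem h hA) (ne_zero_of_mem h hC)] at this

/-- A filter need not contain elements `(∅, A, ∅)`, but it contains elements `(α, A, α)` for every
non-empty beginning `α` of its word, since `I_{αδ}` is generated by `θ_δ(I_α)` if `α ≠ ∅`. -/
theorem exists_elt_mem {ξ : Set D.Sgp} (h : IsIdemFilter ξ) {α : List L} {γ : Word L}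
    (hw : D.IsWordOf ξ (Word.append α γ)) (h0 : α ≠ []) :
    ∃ A, D.elt α A α ∈ ξ := by
  obtain ⟨δ, A, hA, -⟩ := exists_elt_append_mem hw (n := 0) bot_le
  have hAi := (of_elt_ne_zero (ne_zero_of_mem h hA)).1
  cases α with
  | nil => exact absurd rfl h0
  | cons a v =>
    obtain ⟨C, hC, hAC⟩ := hAi
    change A ≤ D.act (v ++ δ) C at hAC
    rw [act_append] at hAC
    exact ⟨D.act v C, elt_up h hA ⟨C, hC, le_rfl⟩ hAC⟩

theorem filterOf_family {ξ : Set D.Sgp} (h : IsIdemFilter ξ) {ω : Word L}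
    (hw : D.IsWordOf ξ ω) : D.filterOf ω (D.family ξ ω) = ξ := by
  ext e
  constructor
  · rintro ⟨he, n, -, A, hA, hle⟩
    exact h.up _ hA.2 e he hle
  · intro he
    obtain ⟨β, A, rfl⟩ := exists_elt_of_idem (ne_zero_of_mem h he) (h.idem e he)
    have hβ := hw.1 _ _ he
    refine ⟨elt_idem _ _, β.length, Word.beginning_le hβ, A, ?_, ?_⟩
    · rw [mem_family h, hβ]
      exact he
    · rw [hβ]
      exact elt_idem _ _

theorem elt_append_mem_of_mem_cutFilter {ξ : Set D.Sgp} (h : IsIdemFilter ξ) {α δ : List L}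
    {γ : Word L} {A : B} (hA : D.elt δ A δ ∈ D.cutFilter α γ ξ) (hAi : A ∈ D.ideal (α ++ δ)) :
    D.elt (α ++ δ) A (α ++ δ) ∈ ξ := by
  obtain ⟨-, -, A', hA', hA'ξ⟩ := of_elt_mem_cutFilter h hA
  exact elt_up (γ := []) h (by simpa using hA'ξ) hAi hA'

/-- Cutting `α` off and then applying `g_{(α)}` gives back the sets with large index. -/
theorem gMap_family_cutFilter {ξ : Set D.Sgp} (h : IsIdemFilter ξ) {α : List L} {γ : Word L}
    (hw : D.IsWordOf ξ (Word.append α γ)) (j : ℕ) :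
    D.gMap α (γ.take j) (D.family (D.cutFilter α γ ξ) γ j) =
      D.family ξ (Word.append α γ) (α.length + j) := by
  ext A
  rw [gMap, Set.mem_inter_iff, mem_family (isIdemFilter_cutFilter h hw), mem_family h,
    Word.take_append]
  constructor
  · rintro ⟨hA, hAi⟩
    exact elt_append_mem_of_mem_cutFilter h hA hAi
  · intro hA
    have hAi := (of_elt_ne_zero (ne_zero_of_mem h hA)).1
    exact ⟨elt_mem_cutFilter h (Word.take_length_take γ j) (D.ideal_append_subset α _ hAi)
      le_rfl hA, hAi⟩

/-- The family of a filter is complete: each of its sets is obtained from any non-empty later set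
by the map `f`. -/
theorem fMap_family {ξ : Set D.Sgp} (h : IsIdemFilter ξ) {ω : Word L} {i m : ℕ} (hi : i ≤ m)
    (hm : (D.family ξ ω m).Nonempty) :
    D.fMap (ω.take i) ((ω.take m).drop i) (D.family ξ ω m) = D.family ξ ω i := by
  have hsplit : ω.take m = ω.take i ++ (ω.take m).drop i := by
    conv_lhs => rw [← List.take_append_drop i (ω.take m), Word.take_take_of_le ω hi]
  obtain ⟨E, hE⟩ := hm
  rw [mem_family h] at hE
  ext A
  simp only [fMap, Set.mem_ofPred_eq, mem_family h]
  generalize (ω.take m).drop i = δ at hsplit ⊢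
  rw [hsplit] at hE ⊢
  constructor
  · rintro ⟨hAi, hA⟩
    exact elt_up h hA hAi le_rfl
  · intro hA
    have hAi := (of_elt_ne_zero (ne_zero_of_mem h hA)).1
    have hAE := elt_inf_mem h hA hE
    exact ⟨hAi, elt_up (γ := []) h (A := D.act δ A ⊓ E) (by simpa using hAE)
      (D.act_mem_ideal δ hAi) inf_le_left⟩

theorem gluedFamily_family_cutFilter {ξ : Set D.Sgp} (h : IsIdemFilter ξ) {α : List L}
    {γ : Word L} (hw : D.IsWordOf ξ (Word.append α γ)) (i : ℕ) :
    D.gluedFamily α γ (D.family (D.cutFilter α γ ξ) γ) i = D.family ξ (Word.append α γ) i := by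
  have hk : (((if γ.length = 0 then 0 else 1 : ℕ)) : ℕ∞) ≤ γ.length := by
    split_ifs with h0
    · simp
    · exact_mod_cast Order.one_le_iff_ne_zero.2 h0
  unfold gluedFamily
  simp only [gMap_family_cutFilter h hw]
  generalize hkd : (if γ.length = 0 then 0 else 1 : ℕ) = k at hk ⊢
  split_ifs with hi
  · rw [Nat.add_sub_cancel' ((Nat.le_add_right _ _).trans hi)]
  -- the set with index `|α| + k ≥ 1` is non-empty, as it belongs to a non-empty beginning
  · refine fMap_family h (by omega) ?_
    have hlen := Word.add_le_length_append (α := α) hk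
    obtain ⟨γ', hγ'⟩ := Word.exists_eq_append (β := (Word.append α γ).take (α.length + k))
      (Word.take_length_take _ _)
    have hw' := hw
    rw [hγ'] at hw'
    obtain ⟨A, hA⟩ := exists_elt_mem h hw' (fun h0 => by
      have := Word.length_take hlen
      rw [h0] at this
      simp only [List.length_nil] at this
      omega)
    exact ⟨A, (mem_family h).2 hA⟩

/-- Gluing `α` back on after cutting it off gives the original filter. -/
theorem glueFilter_cutFilter {ξ : Set D.Sgp} (h : IsIdemFilter ξ) {α : List L} {γ : Word L}
    (hw : D.IsWordOf ξ (Word.append α γ)) : D.glueFilter α γ (D.cutFilter α γ ξ) = ξ := by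
  unfold glueFilter
  rw [funext (gluedFamily_family_cutFilter h hw), filterOf_family h hw]

theorem cut_injective {ξ η : D.T} {α : List L} {γ γ' : Word L} (hξ : word ξ = Word.append α γ)
    (hη : word η = Word.append α γ') (h : cut α γ ξ hξ = cut α γ' η hη) : ξ = η := by
  obtain rfl : γ = γ' := by rw [← word_cut hξ, h, word_cut hη]
  have h' : D.cutFilter α γ ξ.1 = D.cutFilter α γ η.1 := congrArg Subtype.val h
  refine Subtype.ext ?_
  rw [← glueFilter_cutFilter ξ.2.1 (hξ ▸ isWordOf_word ξ), h',
    glueFilter_cutFilter η.2.1 (hη ▸ isWordOf_word η)]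

theorem cut_cut {ξ : D.T} {α κ : List L} {γ : Word L}
    (h : word ξ = Word.append α (Word.append κ γ)) (h' : word ξ = Word.append (α ++ κ) γ) :
    cut κ γ (cut α (Word.append κ γ) ξ h) (word_cut h) = cut (α ++ κ) γ ξ h' :=
  Subtype.ext (cutFilter_cutFilter ξ.2.1 (h ▸ isWordOf_word ξ))

/-! ### Cutting as a translation -/

/-- On the filters containing `(α, A, α)`, cutting `α` is the translation by `(∅, A, α)`. -/
theorem cutFilter_eq_translate {ξ : Set D.Sgp} (h : IsIdemFilter ξ) {α : List L} {γ : Word L}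
    (hw : D.IsWordOf ξ (Word.append α γ)) {A : B} (hA : D.elt α A α ∈ ξ) :
    D.cutFilter α γ ξ = translate (D.elt [] A α) ξ := by
  have hA0 := ne_zero_of_mem h hA
  ext e
  rw [mem_cutFilter h]
  constructor
  · rintro ⟨δ, C, E, rfl, hδ, hC, hEC, hE⟩
    have hC0 := elt_ne_zero_of_le hC hEC (ne_zero_of_mem h hE)
    refine ⟨elt_idem _ _, ?_⟩
    rw [star_elt, conj_elt hA0 hC0]
    exact elt_up (γ := []) h (by simpa using elt_inf_mem h hA hE)
      (D.ideal_lower inf_le_left (D.act_mem_ideal _ (of_elt_ne_zero hA0).1))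
      (inf_le_inf_left _ hEC)
  · rintro ⟨he, heξ⟩
    have he0 : e ≠ 0 := by
      rintro rfl
      rw [mul_zero', zero_mul'] at heξ
      exact h.zero_notMem heξ
    obtain ⟨δ, C, rfl⟩ := exists_elt_of_idem he0 he
    rw [star_elt, conj_elt hA0 he0] at heξ
    have hb := hw.1 _ _ heξ
    rw [List.length_append, Word.take_append] at hb
    exact ⟨δ, C, _, rfl, List.append_cancel_left hb, (of_elt_ne_zero he0).1, inf_le_right, heξ⟩

theorem elt_nil_ne_zero {α β : List L} {A : B} (h : D.elt α A β ≠ 0) : D.elt [] A α ≠ 0 :=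
  elt_ne_zero trivial (of_elt_ne_zero h).1 (of_elt_ne_zero h).2.2

theorem star_mul_elt {α β : List L} {A : B} (h : D.elt α A β ≠ 0) :
    star (D.elt α A β) * D.elt α A β = D.elt β A β := by
  have h' := of_elt_ne_zero h
  rw [star_elt, elt_mul_elt_same (elt_ne_zero h'.2.1 h'.1 h'.2.2) h]

theorem elt_mul_star {α β : List L} {A : B} (h : D.elt α A β ≠ 0) :
    D.elt α A β * star (D.elt α A β) = D.elt α A α := by
  have h' := of_elt_ne_zero h
  rw [star_elt, elt_mul_elt_same h (elt_ne_zero h'.2.1 h'.1 h'.2.2)]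

theorem ne_zero_of_star_mul_mem {ξ : Set D.Sgp} (h : IsIdemFilter ξ) {s : D.Sgp}
    (hs : star s * s ∈ ξ) : s ≠ 0 := by
  rintro rfl
  rw [mul_zero'] at hs
  exact h.zero_notMem hs

theorem elt_right_mem {ξ : Set D.Sgp} (h : IsIdemFilter ξ) {α β : List L} {A : B}
    (hs : star (D.elt α A β) * D.elt α A β ∈ ξ) : D.elt β A β ∈ ξ := by
  rwa [star_mul_elt (ne_zero_of_star_mul_mem h hs)] at hs

theorem elt_left_mem_translation {ξ : D.T} {α β : List L} {A : B}
    (hs : star (D.elt α A β) * D.elt α A β ∈ ξ.1) :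
    D.elt α A α ∈ (translation (D.elt α A β) ξ hs).1 := by
  have := mul_star_mem_translate hs
  rwa [elt_mul_star (ne_zero_of_star_mul_mem ξ.2.1 hs)] at this

/-- Translation by `(β, A, γ)` takes filters with word `γγ'` to filters with word `βγ'`, and does
not change what remains after cutting. -/
theorem exists_cut_translation {ξ : D.T} {β γ : List L} {A : B} {γ' : Word L}
    (hs : star (D.elt β A γ) * D.elt β A γ ∈ ξ.1) (hξ : word ξ = Word.append γ γ') :
    ∃ hη : word (translation (D.elt β A γ) ξ hs) = Word.append β γ',
      cut β γ' (translation (D.elt β A γ) ξ hs) hη = cut γ γ' ξ hξ := by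
  obtain ⟨γ'', hη⟩ := exists_word_eq_append (elt_left_mem_translation hs)
  have hs0 := ne_zero_of_star_mul_mem ξ.2.1 hs
  have key : cut β γ'' (translation (D.elt β A γ) ξ hs) hη = cut γ γ' ξ hξ := by
    refine Subtype.ext ?_
    change D.cutFilter β γ'' (translation (D.elt β A γ) ξ hs).1 = D.cutFilter γ γ' ξ.1
    rw [cutFilter_eq_translate (translation (D.elt β A γ) ξ hs).2.1 (hη ▸ isWordOf_word _)
      (elt_left_mem_translation hs), cutFilter_eq_translate ξ.2.1 (hξ ▸ isWordOf_word _)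
      (elt_right_mem ξ.2.1 hs)]
    refine (IsInverseSemigroupWithZero.translate_translate _ _ _).trans ?_
    rw [elt_mul_elt_same (elt_nil_ne_zero hs0) hs0]
  obtain rfl : γ'' = γ' := by rw [← word_cut hη, key, word_cut hξ]
  exact ⟨hη, key⟩

/-- A pair of tight filters with words `βγ'` and `γγ'` which agree after cutting `β` and `γ` is
related by the translation by `(β, A, γ)`, provided that `(γ, A, γ)` is in the second filter and
`A ∈ I_β`. -/
theorem translation_eq_of_cut_eq {η ξ : D.T} {β γ : List L} {A : B} {γ' : Word L}
    (hs : star (D.elt β A γ) * D.elt β A γ ∈ ξ.1) (hη : word η = Word.append β γ')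
    (hξ : word ξ = Word.append γ γ') (h : cut β γ' η hη = cut γ γ' ξ hξ) :
    translation (D.elt β A γ) ξ hs = η := by
  obtain ⟨h1, h2⟩ := exists_cut_translation hs hξ
  exact cut_injective h1 hη (h2.trans h.symm)

end GBDS

/-! ### Powers of the shift and the boundary path groupoid -/

namespace Word

variable {L : Type*}

theorem append_inj {α β : List L} {γ δ : Word L} (h : append α γ = append β δ)
    (hl : α.length = β.length) : α = β ∧ γ = δ := by
  obtain ⟨κ, rfl, rfl⟩ := append_eq_append h hl.le
  obtain rfl : κ = [] := by simpa using hl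
  exact ⟨by simp, nil_append δ⟩

end Word

namespace GBDS

open IsInverseSemigroupWithZero

variable {B L : Type*} [GeneralizedBooleanAlgebra B] {D : GBDS B L}

theorem cut_eq_cut {ξ : D.T} {α α' : List L} {γ γ' : Word L} (h : word ξ = Word.append α γ)
    (h' : word ξ = Word.append α' γ') (hl : α.length = α'.length) :
    cut α γ ξ h = cut α' γ' ξ h' := by
  obtain ⟨rfl, rfl⟩ := Word.append_inj (h.symm.trans h') hl
  rfl

theorem sigma_eq_cut (ξ : D.T1) {a : L} {γ : Word L} (h : word ξ.1 = Word.append [a] γ) :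
    D.sigma ξ = cut [a] γ ξ.1 h :=
  cut_eq_cut _ h rfl

theorem mem_T1 {ξ : D.T} : ξ ∈ D.T1 ↔ ∃ a γ, word ξ = Word.append [a] γ := by
  constructor
  · intro h
    obtain ⟨p, hp⟩ := Word.exists_cons h
    exact ⟨p.1, p.2, hp⟩
  · rintro ⟨a, γ, h⟩
    change 1 ≤ (word ξ).length
    rw [h]
    simpa using Word.length_append_ge [a] γ

theorem cut_nil {ξ : D.T} {γ : Word L} (h : word ξ = Word.append [] γ) : cut [] γ ξ h = ξ := by
  have hw := h ▸ isWordOf_word ξ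
  refine Subtype.ext ?_
  ext e
  refine (mem_cutFilter ξ.2.1).trans ⟨?_, fun he => ?_⟩
  · rintro ⟨δ, C, A, rfl, -, hC, hAC, hA⟩
    exact elt_up (γ := []) ξ.2.1 (by simpa using hA) hC hAC
  · obtain ⟨δ, C, rfl⟩ := exists_elt_of_idem (ne_zero_of_mem ξ.2.1 he) (ξ.2.1.idem e he)
    rw [Word.nil_append] at hw
    exact ⟨δ, C, C, rfl, hw.1 _ _ he, (of_elt_ne_zero (ne_zero_of_mem ξ.2.1 he)).1, le_rfl, he⟩

/-- The powers of `σ` are the cutting maps. -/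
theorem mem_partialPow_sigma {n : ℕ} {ξ ζ : D.T} :
    ζ ∈ partialPow D.sigma n ξ ↔
      ∃ (α : List L) (γ : Word L) (h : word ξ = Word.append α γ),
        α.length = n ∧ cut α γ ξ h = ζ := by
  induction n generalizing ξ with
  | zero =>
    rw [mem_partialPow_zero]
    constructor
    · rintro rfl
      exact ⟨[], word ζ, (Word.nil_append _).symm, rfl, cut_nil _⟩
    · rintro ⟨α, γ, h, hα, rfl⟩
      obtain rfl := List.length_eq_zero_iff.1 hα
      exact cut_nil h
  | succ n ih =>
    simp only [mem_partialPow_succ, ih]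
    constructor
    · rintro ⟨hξ, α, γ, h, rfl, rfl⟩
      obtain ⟨a, γ', h'⟩ := mem_T1.1 hξ
      have hσ := sigma_eq_cut ⟨ξ, hξ⟩ h'
      obtain rfl : γ' = Word.append α γ := by rw [← word_cut h', ← hσ, h]
      refine ⟨a :: α, γ, h'.trans (Word.append_append [a] α γ).symm, rfl, ?_⟩
      simp only [hσ]
      exact (cut_cut h' _).symm
    · rintro ⟨α, γ, h, hα, rfl⟩
      cases α with
      | nil => simp at hα
      | cons a α =>
        have h' : word ξ = Word.append [a] (Word.append α γ) :=
          h.trans (Word.append_append [a] α γ)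
        have hξ : ξ ∈ D.T1 := mem_T1.2 ⟨a, _, h'⟩
        have hσ := sigma_eq_cut ⟨ξ, hξ⟩ h'
        refine ⟨hξ, α, γ, by rw [hσ, word_cut], by simpa using hα, ?_⟩
        simp only [hσ]
        exact cut_cut h' h

theorem partialPow_sigma_eq_some {ξ : D.T} {α : List L} {γ : Word L}
    (h : word ξ = Word.append α γ) :
    partialPow D.sigma α.length ξ = Part.some (cut α γ ξ h) :=
  Part.eq_some_iff.2 (mem_partialPow_sigma.2 ⟨α, γ, h, rfl, rfl⟩)

theorem boundaryPathGroupoid_eq_renaultDeaconu (D : GBDS B L) :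
    D.boundaryPathGroupoid = renaultDeaconu D.sigma := by
  refine TripleGroupoid.ext ?_
  ext ⟨η, k, ξ⟩
  constructor
  · rintro ⟨α, β, γ, hη, hξ, hk, h⟩
    exact ⟨α.length, β.length, hk, cut α γ η hη, mem_partialPow_sigma.2 ⟨α, γ, hη, rfl, rfl⟩,
      mem_partialPow_sigma.2 ⟨β, γ, hξ, rfl, h.symm⟩⟩
  · rintro ⟨m, n, hk, ζ, hη, hξ⟩
    obtain ⟨α, γ, hη', rfl, rfl⟩ := mem_partialPow_sigma.1 hη
    obtain ⟨β, γ', hξ', rfl, h⟩ := mem_partialPow_sigma.1 hξ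
    obtain rfl : γ' = γ := by rw [← word_cut hξ', h, word_cut hη']
    exact ⟨α, β, γ', hη', hξ', hk, h.symm⟩

/-! ### The shift is a local homeomorphism -/

theorem exists_elt_singleton_mem {ξ : D.T} (h : ξ ∈ D.T1) :
    ∃ a A, D.elt [a] A [a] ∈ ξ.1 := by
  obtain ⟨a, γ, hw⟩ := mem_T1.1 h
  obtain ⟨A, hA⟩ := exists_elt_mem ξ.2.1 (hw ▸ isWordOf_word ξ) (List.cons_ne_nil a [])
  exact ⟨a, A, hA⟩

theorem mem_T1_of_elt_mem {ξ : D.T} {a : L} {A : B} (h : D.elt [a] A [a] ∈ ξ.1) : ξ ∈ D.T1 :=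
  mem_T1.2 ⟨a, exists_word_eq_append h⟩

theorem isOpen_T1 (D : GBDS B L) : IsOpen D.T1 := by
  have h : D.T1 = ⋃ p : L × B, {ξ : D.T | D.elt [p.1] p.2 [p.1] ∈ ξ.1} := by
    ext ξ
    simp only [Set.mem_iUnion, Set.mem_ofPred_eq, Prod.exists]
    exact ⟨exists_elt_singleton_mem, fun ⟨a, A, h⟩ => mem_T1_of_elt_mem h⟩
  rw [h]
  exact isOpen_iUnion fun p => (TightSpectrum.isClopen_mem _).isOpen

theorem star_mul_elt_nil_mem {ξ : D.T} {α : List L} {A : B} (h : D.elt α A α ∈ ξ.1) :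
    star (D.elt [] A α) * D.elt [] A α ∈ ξ.1 := by
  rwa [star_mul_elt (elt_nil_ne_zero (ne_zero_of_mem ξ.2.1 h))]

theorem cut_eq_translation {ξ : D.T} {α : List L} {γ : Word L} (hw : word ξ = Word.append α γ)
    {A : B} (h : D.elt α A α ∈ ξ.1) :
    cut α γ ξ hw = translation (D.elt [] A α) ξ (star_mul_elt_nil_mem h) :=
  Subtype.ext (cutFilter_eq_translate ξ.2.1 (hw ▸ isWordOf_word ξ) h)

theorem sigma_eq_translation (ξ : D.T1) {a : L} {A : B} (h : D.elt [a] A [a] ∈ ξ.1.1) :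
    D.sigma ξ = translation (D.elt [] A [a]) ξ.1 (star_mul_elt_nil_mem h) := by
  obtain ⟨γ, hw⟩ := exists_word_eq_append h
  rw [sigma_eq_cut ξ hw, cut_eq_translation hw h]

/-- On the open set of all `ξ` containing a given `(a, A, a)`, the map `σ` is the translation by
`(∅, A, a)`, which is a homeomorphism onto an open set. -/
theorem isLocalHomeomorph_sigma (D : GBDS B L) : IsLocalHomeomorph D.sigma := by
  rw [isLocalHomeomorph_iff_isOpenEmbedding_restrict]
  intro ξ₀
  obtain ⟨a, A, hA⟩ := exists_elt_singleton_mem ξ₀.2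
  have hU : IsOpen {ξ : D.T1 | D.elt [a] A [a] ∈ ξ.1.1} :=
    (TightSpectrum.isClopen_mem _).isOpen.preimage continuous_subtype_val
  refine ⟨_, hU.mem_nhds hA, .of_continuous_injective_isOpenMap ?_ ?_ ?_⟩
  · refine ((TightSpectrum.continuous_translation (D.elt [] A [a])).comp
      (Continuous.subtype_mk (continuous_subtype_val.comp continuous_subtype_val)
        fun ξ : {ξ : D.T1 | D.elt [a] A [a] ∈ ξ.1.1} => star_mul_elt_nil_mem ξ.2)).congr ?_
    exact fun ξ => (sigma_eq_translation ξ.1 ξ.2).symm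
  · intro ξ ξ' h
    have hw := (exists_word_eq_append ξ.2).choose_spec
    have hw' := (exists_word_eq_append ξ'.2).choose_spec
    have h' : D.sigma ξ.1 = D.sigma ξ'.1 := h
    rw [sigma_eq_cut ξ.1 hw, sigma_eq_cut ξ'.1 hw'] at h'
    exact Subtype.ext (Subtype.ext (cut_injective hw hw' h'))
  · intro V hV
    have hW := (isOpen_T1 D).isOpenEmbedding_subtypeVal.isOpenMap _
      (hU.isOpenEmbedding_subtypeVal.isOpenMap V hV)
    convert isOpen_translation_image (D.elt [] A [a]) hW using 1
    ext η
    constructor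
    · rintro ⟨ξ, hξ, rfl⟩
      exact ⟨ξ.1.1, ⟨ξ.1, ⟨ξ, hξ, rfl⟩, rfl⟩, star_mul_elt_nil_mem ξ.2,
        sigma_eq_translation ξ.1 ξ.2⟩
    · rintro ⟨_, ⟨_, ⟨ξ, hξ, rfl⟩, rfl⟩, h, rfl⟩
      exact ⟨ξ, hξ, sigma_eq_translation ξ.1 ξ.2⟩

end GBDS

/-! ### The tight groupoid and the boundary path groupoid -/

namespace GBDS

open IsInverseSemigroupWithZero

variable {B L : Type*} [GeneralizedBooleanAlgebra B] {D : GBDS B L}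

/-- Two tight filters with words `αγ` and `βγ` which agree after cutting `α` and `β` are related
by the translation by an element `(αδ, A, βδ)` of `S`. -/
theorem exists_elt_of_cut_eq {η ξ : D.T} {α β : List L} {γ : Word L}
    (hη : word η = Word.append α γ) (hξ : word ξ = Word.append β γ)
    (h : cut α γ η hη = cut β γ ξ hξ) :
    ∃ (δ : List L) (γ' : Word L) (A : B), γ = Word.append δ γ' ∧
      ∃ hs : star (D.elt (α ++ δ) A (β ++ δ)) * D.elt (α ++ δ) A (β ++ δ) ∈ ξ.1,
        translation (D.elt (α ++ δ) A (β ++ δ)) ξ hs = η := by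
  have hwη := hη ▸ isWordOf_word η
  have hwξ := hξ ▸ isWordOf_word ξ
  have h' : D.cutFilter α γ η.1 = D.cutFilter β γ ξ.1 := congrArg Subtype.val h
  have hcut := isIdemFilter_cutFilter ξ.2.1 hwξ
  have key : ∃ δ A, D.elt δ A δ ∈ D.cutFilter β γ ξ.1 ∧ A ∈ D.ideal (α ++ δ) ∧
      A ∈ D.ideal (β ++ δ) := by
    obtain ⟨δ₁, A₁, hA₁, hδ₁, -⟩ := exists_elt_append_mem hwη (n := 0) bot_le
    obtain ⟨δ₂, A₂, hA₂, hδ₂, -⟩ := exists_elt_append_mem hwξ (n := 0) bot_le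
    have hi₁ := (of_elt_ne_zero (ne_zero_of_mem η.2.1 hA₁)).1
    have hi₂ := (of_elt_ne_zero (ne_zero_of_mem ξ.2.1 hA₂)).1
    have h₁ := elt_mem_cutFilter η.2.1 hδ₁ (D.ideal_append_subset α _ hi₁) le_rfl hA₁
    have h₂ := elt_mem_cutFilter ξ.2.1 hδ₂ (D.ideal_append_subset β _ hi₂) le_rfl hA₂
    rw [h'] at h₁
    rcases le_total δ₁.length δ₂.length with hl | hl
    · obtain ⟨κ, rfl⟩ := comparable_of_mem hcut h₁ h₂ hl
      refine ⟨_, _, elt_inf_mem hcut h₁ h₂, ?_, D.ideal_lower inf_le_right hi₂⟩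
      rw [← List.append_assoc]
      exact D.ideal_lower inf_le_left (D.act_mem_ideal κ hi₁)
    · obtain ⟨κ, rfl⟩ := comparable_of_mem hcut h₂ h₁ hl
      refine ⟨_, _, elt_inf_mem hcut h₂ h₁, D.ideal_lower inf_le_right hi₁, ?_⟩
      rw [← List.append_assoc]
      exact D.ideal_lower inf_le_left (D.act_mem_ideal κ hi₂)
  obtain ⟨δ, A, hA, hα, hβ⟩ := key
  obtain ⟨γ', rfl⟩ := Word.exists_eq_append (of_elt_mem_cutFilter ξ.2.1 hA).1
  have hAξ := elt_append_mem_of_mem_cutFilter ξ.2.1 hA hβ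
  have hs0 : D.elt (α ++ δ) A (β ++ δ) ≠ 0 :=
    elt_ne_zero hα hβ (of_elt_ne_zero (ne_zero_of_mem ξ.2.1 hAξ)).2.2
  refine ⟨δ, γ', A, rfl, by rwa [star_mul_elt hs0], ?_⟩
  refine translation_eq_of_cut_eq _ (hη.trans (Word.append_append _ _ _).symm)
    (hξ.trans (Word.append_append _ _ _).symm) ?_
  rw [← cut_cut hη, ← cut_cut hξ]
  exact Subtype.ext (congrArg (D.cutFilter δ γ') h')

/-- An element `s = (β, A, γ)` with `s^* s ∈ ξ` gives an arrow of the boundary path groupoid. -/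
theorem translation_mem_boundaryPathGroupoid {ξ : D.T} {s : D.Sgp} (hs : star s * s ∈ ξ.1) :
    (translation s ξ hs, degree s, ξ) ∈ D.boundaryPathGroupoid.carrier := by
  obtain ⟨β, A, γ, rfl⟩ := exists_elt s (ne_zero_of_star_mul_mem ξ.2.1 hs)
  obtain ⟨γ', hξ⟩ := exists_word_eq_append (elt_right_mem ξ.2.1 hs)
  obtain ⟨hη, h⟩ := exists_cut_translation hs hξ
  exact ⟨β, γ, γ', hη, hξ, degree_elt (ne_zero_of_star_mul_mem ξ.2.1 hs), h⟩

/-- The translation and the degree of `s` depend on the germ of `s` at `ξ` only. -/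
theorem translation_congr {ξ : D.T} {s t e : D.Sgp} (hs : star s * s ∈ ξ.1)
    (ht : star t * t ∈ ξ.1) (he : e ∈ ξ.1) (h : s * e = t * e) :
    translation s ξ hs = translation t ξ ht ∧ degree s = degree t := by
  refine ⟨Subtype.ext (translate_congr ξ.2.1 he h),
    degree_congr (ξ.2.1.idem e he) h fun h0 => ?_⟩
  have h1 := mul_mem_filter ξ.2.1 hs he
  rw [IsInverseSemigroupWithZero.mul_assoc, h0, mul_zero'] at h1
  exact ξ.2.1.zero_notMem h1

variable (D) in
/-- The map `[s, ξ] ↦ (s ξ, deg s, ξ)` from the tight groupoid to the boundary path groupoid. -/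
noncomputable def germMap : TightGerm D.Sgp → D.boundaryPathGroupoid.carrier :=
  Quot.lift (fun p => ⟨(translation p.1.1 p.1.2 p.2, degree p.1.1, p.1.2),
    translation_mem_boundaryPathGroupoid p.2⟩) (by
    rintro ⟨⟨s, ξ⟩, hs⟩ ⟨⟨t, ζ⟩, ht⟩ ⟨h, e, -, he, hst⟩
    obtain rfl : ξ = ζ := h
    obtain ⟨h1, h2⟩ := translation_congr hs ht he hst
    exact Subtype.ext (Prod.ext h1 (Prod.ext h2 rfl)))

theorem germMap_germ (s : D.Sgp) (ξ : D.T) (h : star s * s ∈ ξ.1) :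
    (germMap D (germ s ξ h)).1 = (translation s ξ h, degree s, ξ) := rfl

/-- Elements `(β, A, γ)` and `(β', A', γ')` with `|γ| ≤ |γ'|` which have the same degree and
translate `ξ` in the same way satisfy `γ' = γκ` and `β' = βκ` for some `κ`. So they have the same
product with the idempotent `(γκ, θ_κ(A) ∩ A', γκ)`, which belongs to `ξ`. -/
theorem germ_elt_eq_germ_elt {ξ : D.T} {β γ β' γ' : List L} {A A' : B}
    (hs : star (D.elt β A γ) * D.elt β A γ ∈ ξ.1)
    (ht : star (D.elt β' A' γ') * D.elt β' A' γ' ∈ ξ.1) (hl : γ.length ≤ γ'.length)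
    (hd : (β.length : ℤ) - γ.length = (β'.length : ℤ) - γ'.length)
    (h : translation (D.elt β A γ) ξ hs = translation (D.elt β' A' γ') ξ ht) :
    germ (D.elt β A γ) ξ hs = germ (D.elt β' A' γ') ξ ht := by
  have hs0 := ne_zero_of_star_mul_mem ξ.2.1 hs
  have ht0 := ne_zero_of_star_mul_mem ξ.2.1 ht
  have hA := elt_right_mem ξ.2.1 hs
  have hA' := elt_right_mem ξ.2.1 ht
  obtain ⟨κ, rfl⟩ := comparable_of_mem ξ.2.1 hA hA' hl
  obtain ⟨ω, hω⟩ := exists_word_eq_append hA'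
  obtain ⟨h1, -⟩ := exists_cut_translation hs (hω.trans (Word.append_append _ _ _))
  obtain ⟨h2, -⟩ := exists_cut_translation ht hω
  rw [h, h2, ← Word.append_append] at h1
  obtain ⟨rfl, -⟩ := Word.append_inj h1 (by
    simp only [List.length_append] at hd ⊢
    omega)
  have he := elt_inf_mem ξ.2.1 hA hA'
  have he0 := ne_zero_of_mem ξ.2.1 he
  refine Quot.sound ⟨rfl, _, elt_idem _ _, he, ?_⟩
  have e1 := elt_mul_elt_append hs0 he0
  have e2 := elt_mul_elt_append (γ' := []) ht0 (by simpa using he0)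
  simp only [List.append_nil, act, List.foldl_nil] at e2
  refine e1.trans (Eq.trans ?_ e2.symm)
  simp only [act]
  rw [← inf_assoc, inf_idem, inf_left_comm, inf_idem]

theorem germMap_injective : Function.Injective (germMap D) := by
  rintro ⟨⟨s, ξ⟩, hs⟩ ⟨⟨t, ζ⟩, ht⟩ h
  obtain ⟨h1, h2⟩ := Prod.ext_iff.1 (congrArg Subtype.val h)
  obtain ⟨h2, h3⟩ := Prod.ext_iff.1 h2
  obtain rfl : ξ = ζ := h3
  change star s * s ∈ ξ.1 at hs
  change star t * t ∈ ξ.1 at ht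
  change translation s ξ hs = translation t ξ ht at h1
  change degree s = degree t at h2
  change germ s ξ hs = germ t ξ ht
  have hs0 := ne_zero_of_star_mul_mem ξ.2.1 hs
  have ht0 := ne_zero_of_star_mul_mem ξ.2.1 ht
  obtain ⟨β, A, γ, rfl⟩ := exists_elt s hs0
  obtain ⟨β', A', γ', rfl⟩ := exists_elt t ht0
  rw [degree_elt hs0, degree_elt ht0] at h2
  rcases le_total γ.length γ'.length with hl | hl
  · exact germ_elt_eq_germ_elt hs ht hl h2 h1
  · exact (germ_elt_eq_germ_elt ht hs hl h2.symm h1.symm).symm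

theorem germMap_surjective : Function.Surjective (germMap D) := by
  rintro ⟨⟨η, k, ξ⟩, α, β, γ, hη, hξ, hk, h⟩
  obtain ⟨δ, γ', A, -, hs, hact⟩ := exists_elt_of_cut_eq hη hξ h
  refine ⟨germ _ ξ hs, Subtype.ext (Prod.ext hact (Prod.ext ?_ rfl))⟩
  change degree _ = k
  change k = _ at hk
  rw [degree_elt (ne_zero_of_star_mul_mem ξ.2.1 hs), hk]
  simp

variable (D) in
/-- The bijection `[s, ξ] ↦ (s ξ, deg s, ξ)` between the tight groupoid and the boundary path
groupoid. -/
noncomputable def germEquiv : TightGerm D.Sgp ≃ D.boundaryPathGroupoid.carrier :=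
  Equiv.ofBijective (germMap D) ⟨germMap_injective, germMap_surjective⟩

theorem translation_eq_glueFilter {ξ : D.T} {β γ : List L} {A : B} {γ' : Word L}
    (h : star (D.elt β A γ) * D.elt β A γ ∈ ξ.1) (hξ : word ξ = Word.append γ γ') :
    (translation (D.elt β A γ) ξ h).1 = D.glueFilter β γ' (D.cutFilter γ γ' ξ.1) := by
  obtain ⟨hη, hcut⟩ := exists_cut_translation h hξ
  have hcut' : D.cutFilter β γ' (translation (D.elt β A γ) ξ h).1 = D.cutFilter γ γ' ξ.1 :=
    congrArg Subtype.val hcut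
  rw [← hcut', glueFilter_cutFilter (translation _ ξ h).2.1 (hη ▸ isWordOf_word _)]

/-! ### Comparison of the topologies -/

theorem mem_dom_partialPow_sigma {ξ : D.T} {α : List L} {A : B} (h : D.elt α A α ∈ ξ.1) :
    ξ ∈ (partialPow D.sigma α.length).Dom := by
  obtain ⟨γ, hξ⟩ := exists_word_eq_append h
  rw [PFun.mem_dom]
  exact ⟨_, mem_partialPow_sigma.2 ⟨α, γ, hξ, rfl, rfl⟩⟩

theorem partialPow_sigma_eq_iff {η ξ : D.T} {α β : List L} {γ γ' : Word L}
    (hη : word η = Word.append α γ) (hξ : word ξ = Word.append β γ') :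
    partialPow D.sigma α.length η = partialPow D.sigma β.length ξ ↔
      cut α γ η hη = cut β γ' ξ hξ := by
  rw [partialPow_sigma_eq_some hη, partialPow_sigma_eq_some hξ, Part.some_inj]

/-- `σ^{|α|}` is injective on the set of all filters containing `(α, A, α)`. -/
theorem partialPow_sigma_injOn {ξ ξ' : D.T} {α : List L} {A : B} (h : D.elt α A α ∈ ξ.1)
    (h' : D.elt α A α ∈ ξ'.1)
    (heq : partialPow D.sigma α.length ξ = partialPow D.sigma α.length ξ') : ξ = ξ' := by
  obtain ⟨γ, hξ⟩ := exists_word_eq_append h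
  obtain ⟨γ', hξ'⟩ := exists_word_eq_append h'
  exact cut_injective hξ hξ' ((partialPow_sigma_eq_iff hξ hξ').1 heq)

/-- After translation by `(αδ, A, βδ)` already the powers `σ^{|α|}` and `σ^{|β|}` agree, as the
remainders both begin with `δ`. -/
theorem partialPow_sigma_translation {ξ : D.T} {α β δ : List L} {A : B}
    (hs : star (D.elt (α ++ δ) A (β ++ δ)) * D.elt (α ++ δ) A (β ++ δ) ∈ ξ.1) :
    partialPow D.sigma α.length (translation (D.elt (α ++ δ) A (β ++ δ)) ξ hs) =
      partialPow D.sigma β.length ξ := by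
  obtain ⟨γ, hξ⟩ := exists_word_eq_append (elt_right_mem ξ.2.1 hs)
  obtain ⟨hη, h⟩ := exists_cut_translation hs hξ
  have hξ' := hξ.trans (Word.append_append _ _ _)
  have hη' := hη.trans (Word.append_append _ _ _)
  rw [partialPow_sigma_eq_iff hη' hξ']
  refine cut_injective (word_cut hη') (word_cut hξ') ?_
  rw [cut_cut hη' hη, cut_cut hξ' hξ, h]

theorem isOpen_germ_image (s : D.Sgp) {U : Set D.T} (hU : IsOpen U)
    (hUs : ∀ ξ ∈ U, star s * s ∈ ξ.1) :
    IsOpen {g : TightGerm D.Sgp | ∃ ξ, ∃ h : ξ ∈ U, g = germ s ξ (hUs ξ h)} :=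
  TopologicalSpace.isOpen_generateFrom_of_mem ⟨s, U, hU, hUs, rfl⟩

/-- The sets `V(X, m, n, Y)` pull back to open subsets of the tight groupoid. -/
theorem isOpen_germMap_preimage {X Y : Set D.T} (hX : IsOpen X) (hY : IsOpen Y) (m n : ℕ)
    (hXm : X ⊆ (partialPow D.sigma m).Dom) :
    IsOpen {g : TightGerm D.Sgp | (germMap D g).1.2.1 = (m : ℤ) - n ∧ (germMap D g).1.1 ∈ X ∧
      (germMap D g).1.2.2 ∈ Y ∧
      partialPow D.sigma m (germMap D g).1.1 = partialPow D.sigma n (germMap D g).1.2.2} := by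
  rw [isOpen_iff_forall_mem_open]
  rintro g ⟨hk, hgX, hgY, hpow⟩
  -- a representative `(αδ, A, βδ)` of the germ with `|α| = m` and `|β| = n`
  obtain ⟨ζ, hζ⟩ := (PFun.mem_dom _ _).1 (hXm hgX)
  have hζ' := hζ
  rw [hpow] at hζ'
  obtain ⟨α, γ, hη, rfl, rfl⟩ := mem_partialPow_sigma.1 hζ
  obtain ⟨β, γ', hξ, rfl, h⟩ := mem_partialPow_sigma.1 hζ'
  obtain rfl : γ' = γ := by rw [← word_cut hξ, h, word_cut hη]
  obtain ⟨δ, γ'', A, -, hs, hact⟩ := exists_elt_of_cut_eq hη hξ h.symm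
  have hdeg : ∀ ξ : D.T, star (D.elt (α ++ δ) A (β ++ δ)) * D.elt (α ++ δ) A (β ++ δ) ∈ ξ.1 →
      degree (D.elt (α ++ δ) A (β ++ δ)) = (α.length : ℤ) - β.length := by
    intro ξ h'
    rw [degree_elt (ne_zero_of_star_mul_mem ξ.2.1 h')]
    simp
  have hg : g = germ _ _ hs := by
    refine germMap_injective (Subtype.ext ?_)
    rw [germMap_germ, hact, hdeg _ hs, ← hk]
  have hU := (TightSpectrum.isOpen_translation_preimage (D.elt (α ++ δ) A (β ++ δ)) hX).inter hY
  refine ⟨_, ?_, isOpen_germ_image _ hU fun ξ h => h.1.choose, _,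
    ⟨⟨hs, by rw [hact]; exact hgX⟩, hgY⟩, hg⟩
  rintro _ ⟨ξ, ⟨⟨hsξ, hξX⟩, hξY⟩, rfl⟩
  exact ⟨hdeg ξ hsξ, hξX, hξY, partialPow_sigma_translation hsξ⟩

/-- The image of `{[s, ξ] | ξ ∈ U}` for `s = (β, A, γ)` is the set `V(X, |β|, |γ|, U)`, where `X`
consists of all filters containing `(β, A, β)`. -/
theorem mem_germ_image_iff {β γ : List L} {A : B} {U : Set D.T}
    (hU : ∀ ξ ∈ U, star (D.elt β A γ) * D.elt β A γ ∈ ξ.1) (g : TightGerm D.Sgp) :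
    (∃ ξ, ∃ h : ξ ∈ U, g = germ (D.elt β A γ) ξ (hU ξ h)) ↔
      (germMap D g).1.2.1 = (β.length : ℤ) - γ.length ∧ D.elt β A β ∈ (germMap D g).1.1.1 ∧
        (germMap D g).1.2.2 ∈ U ∧ partialPow D.sigma β.length (germMap D g).1.1 =
          partialPow D.sigma γ.length (germMap D g).1.2.2 := by
  constructor
  · rintro ⟨ξ, h, rfl⟩
    have hs := hU ξ h
    obtain ⟨γ', hξ⟩ := exists_word_eq_append (elt_right_mem ξ.2.1 hs)
    obtain ⟨hη, hcut⟩ := exists_cut_translation hs hξ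
    exact ⟨degree_elt (ne_zero_of_star_mul_mem ξ.2.1 hs), elt_left_mem_translation hs, h,
      (partialPow_sigma_eq_iff hη hξ).2 hcut⟩
  · rintro ⟨hk, hβ, hgU, hpow⟩
    have hs := hU _ hgU
    obtain ⟨γ', hη⟩ := exists_word_eq_append hβ
    obtain ⟨γ'', hξ⟩ := exists_word_eq_append (elt_right_mem (germMap D g).1.2.2.2.1 hs)
    have hcut := (partialPow_sigma_eq_iff hη hξ).1 hpow
    obtain rfl : γ' = γ'' := by rw [← word_cut hη, hcut, word_cut hξ]
    refine ⟨_, hgU, germMap_injective (Subtype.ext ?_)⟩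
    rw [germMap_germ, translation_eq_of_cut_eq hs hη hξ hcut,
      degree_elt (ne_zero_of_star_mul_mem (germMap D g).1.2.2.2.1 hs), ← hk]

open Topology in
/-- The topology of the tight groupoid, transported to the boundary path groupoid, is the
Renault–Deaconu topology. -/
theorem coinduced_germEquiv
    (hΓ : D.boundaryPathGroupoid.carrier = (renaultDeaconu D.sigma).carrier) :
    TopologicalSpace.coinduced (germEquiv D) inferInstance =
      TopologicalSpace.induced (Equiv.setCongr hΓ) (renaultDeaconuTopology D.sigma) := by
  refine le_antisymm ?_ ?_
  · rw [renaultDeaconuTopology, induced_generateFrom_eq]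
    refine le_generateFrom ?_
    rintro _ ⟨_, ⟨X, m, n, Y, hX, hXm, -, hY, -, -, rfl⟩, rfl⟩
    exact isOpen_coinduced.2 (isOpen_germMap_preimage hX hY m n hXm)
  · rw [← Equiv.induced_symm]
    change _ ≤ TopologicalSpace.induced (germEquiv D).symm (TopologicalSpace.generateFrom _)
    rw [induced_generateFrom_eq (f := (germEquiv D).symm)]
    refine le_generateFrom ?_
    rintro _ ⟨_, ⟨s, U, hU, hUs, rfl⟩, rfl⟩
    -- no `ξ` contains `0`, so that `U = ∅` if `s = 0`
    by_cases hs : s = 0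
    · convert @isOpen_empty _ (TopologicalSpace.induced (Equiv.setCongr hΓ)
        (renaultDeaconuTopology D.sigma))
      refine Set.eq_empty_iff_forall_notMem.2 ?_
      rintro p ⟨ξ, h, -⟩
      exact ne_zero_of_star_mul_mem ξ.2.1 (hUs ξ h) hs
    obtain ⟨β, A, γ, rfl⟩ := exists_elt s hs
    have hV : IsOpen[renaultDeaconuTopology D.sigma] {p : (renaultDeaconu D.sigma).carrier |
        p.1.2.1 = (β.length : ℤ) - γ.length ∧ p.1.1 ∈ {η : D.T | D.elt β A β ∈ η.1} ∧
        p.1.2.2 ∈ U ∧ partialPow D.sigma β.length p.1.1 = partialPow D.sigma γ.length p.1.2.2} :=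
      TopologicalSpace.isOpen_generateFrom_of_mem
        ⟨{η : D.T | D.elt β A β ∈ η.1}, β.length, γ.length, U,
          (TightSpectrum.isClopen_mem _).isOpen, fun η h => mem_dom_partialPow_sigma h,
          fun η h η' h' => partialPow_sigma_injOn h h', hU,
          fun ξ h => mem_dom_partialPow_sigma (elt_right_mem ξ.2.1 (hUs ξ h)),
          fun ξ h ξ' h' => partialPow_sigma_injOn (elt_right_mem ξ.2.1 (hUs ξ h))
            (elt_right_mem ξ'.2.1 (hUs ξ' h')), rfl⟩
    refine (isOpen_induced_iff (t := renaultDeaconuTopology D.sigma)).2 ⟨_, hV, ?_⟩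
    ext p
    obtain ⟨g, rfl⟩ := (germEquiv D).surjective p
    refine Iff.trans ?_ (Iff.trans (mem_germ_image_iff hUs g).symm ?_)
    · exact Iff.rfl
    · simp only [Set.mem_preimage, Equiv.symm_apply_apply, Set.mem_ofPred_eq]

end GBDS

theorem mainTheorem5 {B L : Type*} [GeneralizedBooleanAlgebra B] (D : GBDS B L) :
    IsOpen D.T1 ∧
    IsLocalHomeomorph D.sigma ∧
    ∃ hΓ : D.boundaryPathGroupoid = renaultDeaconu D.sigma,
    ∃ Φ : TightGerm D.Sgp ≃ D.boundaryPathGroupoid.carrier,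
      (∀ (β γ : List L) (A : B) (γ' : Word L) (ξ : D.T)
        (h : star (D.elt β A γ) * D.elt β A γ ∈ ξ.1), GBDS.word ξ = Word.append γ γ' →
        (Φ (germ (D.elt β A γ) ξ h)).1.1.1 = D.glueFilter β γ' (D.cutFilter γ γ' ξ.1) ∧
        (Φ (germ (D.elt β A γ) ξ h)).1.2 = ((β.length : ℤ) - γ.length, ξ)) ∧
      TopologicalSpace.coinduced Φ inferInstance =
        TopologicalSpace.induced (Equiv.setCongr (congrArg TripleGroupoid.carrier hΓ))
          (renaultDeaconuTopology D.sigma) := by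
  refine ⟨GBDS.isOpen_T1 D, GBDS.isLocalHomeomorph_sigma D,
    GBDS.boundaryPathGroupoid_eq_renaultDeaconu D, GBDS.germEquiv D, ?_,
    GBDS.coinduced_germEquiv _⟩
  intro β γ A γ' ξ h hξ
  refine ⟨GBDS.translation_eq_glueFilter h hξ, ?_⟩
  exact Prod.ext (GBDS.degree_elt (GBDS.ne_zero_of_star_mul_mem ξ.2.1 h)) rfl
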